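/- Let $k$ be a field of characteristic different from $2$ and $3$, let $\Gamma$ be a commutative group, and let $\varepsilon:\Gamma\times\Gamma\to k\setminus\{0\}$ be a commutation factor, i.e. $\varepsilon$ is bimultiplicative and $\varepsilon(\alpha,\beta)\varepsilon(\beta,\alpha)=1$. Let $g=\bigoplus_{\gamma\in\Gamma}g_\gamma$ be a finite-dimensional abelian color Lie algebra (a $\Gamma$-graded $\varepsilon$-Lie algebra with zero bracket) over $k$. Let $U(g)$ be its universal enveloping algebra, i.e. the quotient of the tensor algebra $T(g)$ by the relations $ab-\varepsilon(\alpha,\beta)ba=0$ for $a\in g_\alpha$, $b\in g_\beta$, with the augmentation $U(g)\to k$ that sends $g$ to $0$ and with the $\mathbb{Z}_{\ge 0}$-grading in which $g$ has degree $1$. Let $W$ be a set of homogeneous elements of $g$ (for instance a subset of a homogeneous basis of $g$), let $W\,U(g)$ be the right ideal generated by $W$, and let $M=U(g)/W\,U(g)$ be the cyclic graded right $U(g)$-module. Put $H_i(g,M)=\operatorname{Tor}_i^{U(g)}(M,k)$, with the grading $H_i(g,M)=\bigoplus_j H_i(g,M)_j$ induced by the gradings of $U(g)$ and $M$. Then for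 every $i\ge 0$ the graded vector space $H_i(g,M)$ is concentrated in degree $i$, i.e. $H_i(g,M)_j=0$ for all $j\ne i$. In other words, $U(g)$ is a standard graded algebra (connected, generated in degree one, with finite-dimensional components) and $M$ is a Koszul module over it, generated in degree $0$. -/

import Mathlib

open scoped TensorProduct DirectSum
open MulOpposite

universe u v w

noncomputable section

/-! ### Color Lie algebras -/

/-- A commutation factor on the commutative group `Γ` with values in `k \ {0}`. -/
structure CommutationFactor (Γ : Type w) (k : Type u) [AddCommGroup Γ] [Field k] where
  toFun : Γ → Γ → kˣ
  add_left : ∀ α β γ, toFun (α + β) γ = toFun α γ * toFun β γ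
  add_right : ∀ α β γ, toFun α (β + γ) = toFun α β * toFun α γ
  skew : ∀ α β, toFun α β * toFun β α = 1

/-- A `Γ`-graded `ε`-Lie algebra (color Lie algebra) structure on the `k`-vector space `g`. -/
structure ColorLieAlgebra {Γ : Type w} {k : Type u} [AddCommGroup Γ] [DecidableEq Γ] [Field k]
    (ε : CommutationFactor Γ k) (g : Type v) [AddCommGroup g] [Module k g] where
  /-- the homogeneous components of `g` -/
  comp : Γ → Submodule k g
  isInternal : DirectSum.IsInternal comp
  bracket : g →ₗ[k] g →ₗ[k] g
  bracket_mem : ∀ α β, ∀ a ∈ comp α, ∀ b ∈ comp β, bracket a b ∈ comp (α + β)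
  bracket_skew : ∀ α β, ∀ a ∈ comp α, ∀ b ∈ comp β,
    bracket a b = -((ε.toFun α β : k) • bracket b a)
  jacobi : ∀ α β γ, ∀ a ∈ comp α, ∀ b ∈ comp β, ∀ c ∈ comp γ,
    (ε.toFun γ α : k) • bracket a (bracket b c) + (ε.toFun β γ : k) • bracket c (bracket a b)
      + (ε.toFun α β : k) • bracket b (bracket c a) = 0

namespace ColorLieAlgebra

variable {Γ : Type w} {k : Type u} [AddCommGroup Γ] [DecidableEq Γ] [Field k]
  {ε : CommutationFactor Γ k} {g : Type v} [AddCommGroup g] [Module k g]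
  (L : ColorLieAlgebra ε g)

/-- `g` is abelian: the bracket vanishes. -/
def IsAbelian : Prop := ∀ a b : g, L.bracket a b = 0

/-- `a` is homogeneous: it lies in one of the components. -/
def IsHomogeneous (a : g) : Prop := ∃ γ, a ∈ L.comp γ

/-- The relations `a b - ε(α, β) b a = ⟨a, b⟩` for homogeneous `a`, `b` of degrees `α`, `β`. -/
inductive Rel : TensorAlgebra k g → TensorAlgebra k g → Prop
  | mk (α β : Γ) (a b : g) (ha : a ∈ L.comp α) (hb : b ∈ L.comp β) :
      Rel (TensorAlgebra.ι k a * TensorAlgebra.ι k b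
            - (ε.toFun α β : k) • (TensorAlgebra.ι k b * TensorAlgebra.ι k a))
          (TensorAlgebra.ι k (L.bracket a b))

/-- The universal enveloping algebra `U(g)`. -/
abbrev UEA : Type (max u v) := RingQuot L.Rel

/-- The canonical map `g → U(g)`. -/
def ι : g →ₗ[k] L.UEA :=
  (RingQuot.mkAlgHom k L.Rel).toLinearMap ∘ₗ TensorAlgebra.ι k

/-- The augmentation `U(g) → k`, which sends `g` to `0`. -/
def aug : L.UEA →ₐ[k] k :=
  RingQuot.liftAlgHom k ⟨TensorAlgebra.lift k (0 : g →ₗ[k] k), by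
    rintro _ _ ⟨α, β, a, b, ha, hb⟩
    simp⟩

/-- The degree `n` part of `U(g)`: the span of the products of `n` elements of `g`.
For abelian `g` the relations are homogeneous, and these are the components of a grading. -/
def ueaDeg (n : ℕ) : Submodule k L.UEA := LinearMap.range L.ι ^ n

/-- The right ideal `W U(g)`. -/
abbrev rightIdeal (W : Set g) : Submodule (L.UEA)ᵐᵒᵖ L.UEA :=
  Submodule.span (L.UEA)ᵐᵒᵖ (L.ι '' W)

/-- The cyclic right module `U(g) / W U(g)`. -/
abbrev CyclicModule (W : Set g) : Type (max u v) := L.UEA ⧸ L.rightIdeal W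

/-- The grading of `U(g) / W U(g)` induced from `U(g)`. -/
def cyclicDeg (W : Set g) (n : ℕ) : Submodule k (L.CyclicModule W) :=
  (L.ueaDeg n).map ((L.rightIdeal W).mkQ.restrictScalars k)

end ColorLieAlgebra

/-! ### The graded vector spaces `Tor_i^R(M, k)`

`R` is an augmented `k`-algebra and `M` a right `R`-module (a module over `Rᵐᵒᵖ`). As `k` is a field,
`Tor_i^R(M, k)` is the homology of the bar complex `M ⊗ R ⊗ ⋯ ⊗ R`, which arises from the standard
free resolution of `M` by applying `- ⊗_R k`. -/

namespace Bar

variable {k : Type u} [Field k] {R M : Type w} [Ring R] [Algebra k R] [AddCommGroup M]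
  [Module k M] [Module Rᵐᵒᵖ M] [IsScalarTower k Rᵐᵒᵖ M]

variable (k R M) in
/-- `M ⊗ R ⊗ ⋯ ⊗ R` with `n` factors `R`. -/
def Obj : ℕ → ModuleCat.{w} k
  | 0 => ModuleCat.of k M
  | n + 1 => ModuleCat.of k (Obj n ⊗[k] R)

variable (k R M) in
/-- The right action of `R` on `M` as a linear map, `m ⊗ r ↦ m r`. -/
def act : M ⊗[k] R →ₗ[k] M :=
  TensorProduct.lift (LinearMap.mk₂ k (fun m r => op r • m)
    (fun m m' r => smul_add _ m m')
    (fun c m r => smul_comm _ c m)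
    (fun m r r' => by rw [op_add, add_smul])
    (fun c m r => by rw [op_smul, smul_assoc]))

variable (k R M) in
/-- Right multiplication on the last factor:
`m ⊗ r ↦ m r` for `n = 0` and `(x ⊗ s) ⊗ r ↦ x ⊗ s r` for `n ≥ 1`. -/
def rightMul : (n : ℕ) → (Obj k R M n ⊗[k] R →ₗ[k] Obj k R M n)
  | 0 => act k R M
  | n + 1 => LinearMap.lTensor (Obj k R M n) (LinearMap.mul' k R)
      ∘ₗ (TensorProduct.assoc k (Obj k R M n) R R).toLinearMap

variable (k R M) in
/-- The differential of the standard free resolution of `M`, including the augmentation to `M`: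
`m ⊗ r₁ ⊗ ⋯ ⊗ rₙ₊₁ ↦ m r₁ ⊗ ⋯ ⊗ rₙ₊₁ + ∑ i, (-1)^i m ⊗ ⋯ ⊗ rᵢ rᵢ₊₁ ⊗ ⋯ ⊗ rₙ₊₁`. -/
def resD : (n : ℕ) → (Obj k R M (n + 1) →ₗ[k] Obj k R M n)
  | 0 => rightMul k R M 0
  | n + 1 =>
    let a : Obj k R M (n + 2) →ₗ[k] Obj k R M (n + 1) := LinearMap.rTensor R (resD n)
    let b : Obj k R M (n + 2) →ₗ[k] Obj k R M (n + 1) := rightMul k R M (n + 1)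
    a + (-1 : k) ^ (n + 1) • b

variable (M) in
/-- The augmentation on the last factor, `x ⊗ r ↦ ε(r) x`. -/
def augLast (ε : R →ₐ[k] k) (n : ℕ) : Obj k R M (n + 1) →ₗ[k] Obj k R M n :=
  (TensorProduct.rid k (Obj k R M n)).toLinearMap
    ∘ₗ LinearMap.lTensor (Obj k R M n) ε.toLinearMap

variable (M) in
/-- The differential of the bar complex:
`m ⊗ r₁ ⊗ ⋯ ⊗ rₙ₊₁ ↦ m r₁ ⊗ ⋯ ⊗ rₙ₊₁ + ∑ i, (-1)^i m ⊗ ⋯ ⊗ rᵢ rᵢ₊₁ ⊗ ⋯ ⊗ rₙ₊₁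
  + (-1)^(n + 1) ε(rₙ₊₁) m ⊗ r₁ ⊗ ⋯ ⊗ rₙ`. -/
def d (ε : R →ₐ[k] k) (n : ℕ) : Obj k R M (n + 1) →ₗ[k] Obj k R M n :=
  resD k R M n + (-1 : k) ^ (n + 1) • augLast M ε n

variable (k R M) in
/-- The pure tensor `x ⊗ r`. -/
def tmul (n : ℕ) : Obj k R M n →ₗ[k] R →ₗ[k] Obj k R M (n + 1) :=
  TensorProduct.mk k (Obj k R M n) R

theorem rightMul_zero_tmul (m : M) (r : R) :
    rightMul k R M 0 ((m : Obj k R M 0) ⊗ₜ[k] r) = (op r • m : M) := rfl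

theorem rightMul_succ_tmul (n : ℕ) (x : Obj k R M n) (s r : R) :
    rightMul k R M (n + 1) (tmul k R M n x s ⊗ₜ[k] r) = tmul k R M n x (s * r) := rfl

theorem resD_zero_tmul (x : Obj k R M 0) (r : R) :
    resD k R M 0 (tmul k R M 0 x r) = rightMul k R M 0 (x ⊗ₜ[k] r) := rfl

theorem resD_succ_tmul (n : ℕ) (x : Obj k R M (n + 1)) (r : R) :
    resD k R M (n + 1) (tmul k R M (n + 1) x r)
      = tmul k R M n (resD k R M n x) r
        + (-1 : k) ^ (n + 1) • rightMul k R M (n + 1) (x ⊗ₜ[k] r) := rfl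

theorem augLast_tmul (ε : R →ₐ[k] k) (n : ℕ) (x : Obj k R M n) (r : R) :
    augLast M ε n (tmul k R M n x r) = ε r • x := rfl

theorem induction_tmul {n : ℕ} {p : Obj k R M (n + 1) → Prop} (x : Obj k R M (n + 1))
    (h0 : p 0) (ht : ∀ x r, p (tmul k R M n x r)) (ha : ∀ x y, p x → p y → p (x + y)) : p x :=
  TensorProduct.induction_on (motive := p) x h0 ht ha

theorem rightMul_assoc (n : ℕ) (x : Obj k R M n) (s r : R) :
    rightMul k R M n (rightMul k R M n (x ⊗ₜ[k] s) ⊗ₜ[k] r)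
      = rightMul k R M n (x ⊗ₜ[k] (s * r)) := by
  cases n with
  | zero =>
    have h : ∀ m : M, (op r • op s • m : M) = op (s * r) • m := fun m => by rw [op_mul, mul_smul]
    exact h x
  | succ n =>
    induction x using induction_tmul with
    | h0 => simp
    | ht x t => simp only [rightMul_succ_tmul, mul_assoc]
    | ha x y hx hy => simp only [TensorProduct.add_tmul, map_add, hx, hy]

theorem resD_rightMul (n : ℕ) (x : Obj k R M (n + 1)) (r : R) :
    resD k R M n (rightMul k R M (n + 1) (x ⊗ₜ[k] r))
      = rightMul k R M n (resD k R M n x ⊗ₜ[k] r) := by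
  induction x using induction_tmul with
  | h0 => simp
  | ht x s =>
    rw [rightMul_succ_tmul]
    cases n with
    | zero => rw [resD_zero_tmul, resD_zero_tmul, rightMul_assoc]
    | succ n =>
      rw [resD_succ_tmul, resD_succ_tmul, TensorProduct.add_tmul, map_add, rightMul_succ_tmul,
        ← TensorProduct.smul_tmul', map_smul, rightMul_assoc]
  | ha x y hx hy => simp only [TensorProduct.add_tmul, map_add, hx, hy]

theorem resD_resD (n : ℕ) (x : Obj k R M (n + 2)) :
    resD k R M n (resD k R M (n + 1) x) = 0 := by
  induction n with
  | zero =>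
    induction x using induction_tmul with
    | h0 => simp
    | ht x r =>
      rw [resD_succ_tmul, map_add, map_smul, resD_rightMul, resD_zero_tmul]
      simp
    | ha x y hx hy => rw [map_add, map_add, hx, hy, add_zero]
  | succ n ih =>
    induction x using induction_tmul with
    | h0 => simp
    | ht x r =>
      rw [resD_succ_tmul, map_add, map_smul, resD_rightMul, resD_succ_tmul, ih, map_zero,
        LinearMap.zero_apply, zero_add, ← add_smul, pow_succ _ (n + 1)]
      simp
    | ha x y hx hy => rw [map_add, map_add, hx, hy, add_zero]

theorem augLast_rightMul (ε : R →ₐ[k] k) (n : ℕ) (x : Obj k R M (n + 1)) (r : R) :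
    augLast M ε n (rightMul k R M (n + 1) (x ⊗ₜ[k] r)) = ε r • augLast M ε n x := by
  induction x using induction_tmul with
  | h0 => simp
  | ht x s => rw [rightMul_succ_tmul, augLast_tmul, augLast_tmul, map_mul, mul_comm, mul_smul]
  | ha x y hx hy => simp only [TensorProduct.add_tmul, map_add, hx, hy, smul_add]

theorem d_d (ε : R →ₐ[k] k) (n : ℕ) : d M ε n ∘ₗ d M ε (n + 1) = 0 := by
  ext1 x
  induction x using induction_tmul with
  | h0 => simp
  | ht x r =>
    have h := resD_resD n (tmul k R M (n + 1) x r)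
    simp only [d, LinearMap.comp_apply, LinearMap.add_apply, LinearMap.smul_apply, map_add,
      map_smul, h, augLast_tmul, LinearMap.zero_apply]
    simp only [resD_succ_tmul, map_add, map_smul, augLast_tmul, augLast_rightMul]
    module
  | ha x y hx hy => rw [map_add, hx, hy]; simp

variable (M) in
/-- The bar complex `⋯ ⟶ M ⊗ R ⊗ R ⟶ M ⊗ R ⟶ M`. -/
def complex (ε : R →ₐ[k] k) : ChainComplex (ModuleCat.{w} k) ℕ :=
  ChainComplex.of (Obj k R M) (fun n => ModuleCat.ofHom (d M ε n)) (fun n =>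
    ModuleCat.hom_ext (d_d ε n))

/-- The homogeneous part of degree `j` of `M ⊗ R ⊗ ⋯ ⊗ R`, for gradings `𝒜` of `R` and `ℳ` of `M`:
the span of the `m ⊗ r₁ ⊗ ⋯ ⊗ rₙ` with homogeneous entries whose degrees add up to `j`. -/
def objDeg (𝒜 : ℕ → Submodule k R) (ℳ : ℕ → Submodule k M) :
    (n : ℕ) → ℕ → Submodule k (Obj k R M n)
  | 0 => ℳ
  | n + 1 => fun j => ⨆ p ∈ Finset.HasAntidiagonal.antidiagonal j,
      Submodule.map₂ (tmul k R M n) (objDeg 𝒜 ℳ n p.1) (𝒜 p.2)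

end Bar

section Homology

variable {k : Type u} [Field k] {R M : Type w} [Ring R] [Algebra k R] [AddCommGroup M]
  [Module k M] [Module Rᵐᵒᵖ M] [IsScalarTower k Rᵐᵒᵖ M]

variable (M) in
/-- `H_i(R, M) = Tor_i^R(M, k)`, where `k` is a left `R`-module through the augmentation `ε`. -/
abbrev algHomology (ε : R →ₐ[k] k) (i : ℕ) : ModuleCat.{w} k :=
  (Bar.complex M ε).homology i

/-- `H_i(R, M)_j`: the classes of the homogeneous cycles of degree `j`. -/
def algHomologyDeg (ε : R →ₐ[k] k) (𝒜 : ℕ → Submodule k R) (ℳ : ℕ → Submodule k M) (i j : ℕ) :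
    Submodule k (algHomology M ε i) :=
  ((Bar.objDeg 𝒜 ℳ i j).comap ((Bar.complex M ε).iCycles i).hom).map
    ((Bar.complex M ε).homologyπ i).hom

/-- `R`, with the grading `𝒜` and the augmentation `ε`, is a standard algebra: positively graded
with finite-dimensional components, connected, and generated in degree one;
`ε` is the projection to `R₀ = k`. -/
structure IsStandardGraded (ε : R →ₐ[k] k) (𝒜 : ℕ → Submodule k R) : Prop where
  internal : DirectSum.IsInternal 𝒜
  graded : SetLike.GradedMonoid 𝒜
  finite : ∀ n, Module.Finite k (𝒜 n)
  connected : 𝒜 0 = 1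
  generated : Algebra.adjoin k (𝒜 1 : Set R) = ⊤
  aug_eq_zero : ∀ n, 0 < n → ∀ r ∈ 𝒜 n, ε r = 0

/-- `M` is a positively graded right module over the graded algebra `R`. -/
structure IsGradedRightModule (𝒜 : ℕ → Submodule k R) (ℳ : ℕ → Submodule k M) : Prop where
  internal : DirectSum.IsInternal ℳ
  smul_mem : ∀ i j, ∀ m ∈ ℳ i, ∀ r ∈ 𝒜 j, op r • m ∈ ℳ (i + j)
  finite : ∀ n, Module.Finite k (ℳ n)

/-- The graded right module `M` over the standard algebra `R` is Koszul, generated in degree `d`: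
the graded vector space `H_i(R, M)` is concentrated in degree `i + d` for all `i`. -/
structure IsKoszulModule (ε : R →ₐ[k] k) (𝒜 : ℕ → Submodule k R) (ℳ : ℕ → Submodule k M)
    (d : ℕ) : Prop where
  standard : IsStandardGraded ε 𝒜
  graded : IsGradedRightModule 𝒜 ℳ
  internal : ∀ i, DirectSum.IsInternal (algHomologyDeg ε 𝒜 ℳ i)
  concentrated : ∀ i j, j ≠ i + d → algHomologyDeg ε 𝒜 ℳ i j = ⊥

end Homology

namespace ColorLieAlgebra

variable {Γ : Type w} {k : Type u} [AddCommGroup Γ] [DecidableEq Γ] [Field k]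
  {ε : CommutationFactor Γ k} {g : Type v} [AddCommGroup g] [Module k g]
  (L : ColorLieAlgebra ε g)

/-- `H_i(g, M) = H_i(U(g), M)` for `M = U(g) / W U(g)`. -/
abbrev homology (W : Set g) (i : ℕ) : ModuleCat.{max u v} k :=
  algHomology (L.CyclicModule W) L.aug i

/-- The degree `j` part of `H_i(g, U(g) / W U(g))`. -/
abbrev homologyDeg (W : Set g) (i j : ℕ) : Submodule k (L.homology W i) :=
  algHomologyDeg L.aug L.ueaDeg (L.cyclicDeg W) i j

end ColorLieAlgebra

end

/-! The right ideals generated by sets of basis elements form a Koszul filtration of `U(g)`. Choose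
a homogeneous basis `x i` of `g` in which part of the basis lies in `W` and spans the same space as
`W`. Then `U(g)` is a skew polynomial algebra: `x i * x j = q i j • (x j * x i)`, and `x i` squares
to zero whenever `q i i ≠ 1`. It acts on a space of formal monomials (`exists_isSkewPolynomial`),
and applying an element to the monomial `1` gives coefficients from which the element is recovered
(`eval_coeffs`). Membership in the ideal `I_S` generated by the `x s`, `s ∈ S`, can thus be read off
monomials.

For `i ∉ S`, the elements `r` with `x i * r ∈ I_S` form `I_S` itself if `q i i = 1`, and `I_{S ∪
{i}}` otherwise (`gen_mul_mem_iff`). So left multiplication by `x i` gives an exact sequence `0 ⟶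
A/I_T(-1) ⟶ A/I_S ⟶ A/I_{S ∪ {i}} ⟶ 0` with `T` again a set of generators. By the long exact
sequence, `H_{n+1}(A/I_{S ∪ {i}})_j` vanishes once `H_{n+1}(A/I_S)_j` and `H_n(A/I_T)_{j-1}` do
(`VanishesAt.of_shortExact`). `IsSkewPolynomial.vanishesAt` concludes by an outer induction on the
homological degree and an inner one on `S`. It starts from cyclicity in homological degree `0` and
from the free module `A` for `S = ∅`. -/

set_option linter.unusedSectionVars false

noncomputable section

/-! ### Gradings of vector spaces and their projections -/

section Grading

variable {k : Type*} [Field k] {V W : Type*} [AddCommGroup V] [Module k V]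
  [AddCommGroup W] [Module k W]

/-- `π` is the family of projections onto the components of the grading `𝒱`. -/
structure IsGradingProj (𝒱 : ℕ → Submodule k V) (π : ℕ → V →ₗ[k] V) : Prop where
  self : ∀ j, ∀ x ∈ 𝒱 j, π j x = x
  ne : ∀ i j, i ≠ j → ∀ x ∈ 𝒱 i, π j x = 0
  top : ⨆ j, 𝒱 j = ⊤

namespace IsGradingProj

variable {𝒱 : ℕ → Submodule k V} {π : ℕ → V →ₗ[k] V} {𝒲 : ℕ → Submodule k W}
  {ρ : ℕ → W →ₗ[k] W}

theorem induction (h : IsGradingProj 𝒱 π) {p : V → Prop} (x : V)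
    (hom : ∀ j, ∀ x ∈ 𝒱 j, p x) (add : ∀ x y, p x → p y → p (x + y)) : p x :=
  Submodule.iSup_induction 𝒱 (motive := p) (h.top ▸ Submodule.mem_top : x ∈ ⨆ j, 𝒱 j) hom
    (hom 0 0 (zero_mem _)) add

theorem mem (h : IsGradingProj 𝒱 π) (j : ℕ) (x : V) : π j x ∈ 𝒱 j := by
  induction x using h.induction with
  | hom i x hx =>
    by_cases hij : i = j
    · subst hij; rwa [h.self i x hx]
    · rw [h.ne i j hij x hx]; exact zero_mem _
  | add x y hx hy => rw [map_add]; exact add_mem hx hy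

/-- The identity is asked for all large `n`, so that the bounds for two summands can be merged by
taking their maximum. -/
theorem exists_sum (h : IsGradingProj 𝒱 π) (x : V) :
    ∃ N, ∀ n ≥ N, x = ∑ j ∈ Finset.range n, π j x := by
  induction x using h.induction with
  | hom i x hx =>
    refine ⟨i + 1, fun n hn => ?_⟩
    rw [Finset.sum_eq_single i (fun j _ hj => h.ne i j hj.symm x hx)
      (fun hi => absurd (Finset.mem_range.2 hn) hi), h.self i x hx]
  | add x y hx hy =>
    obtain ⟨N, hN⟩ := hx
    obtain ⟨N', hN'⟩ := hy
    refine ⟨max N N', fun n hn => ?_⟩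
    simp only [map_add, Finset.sum_add_distrib]
    rw [← hN n (le_of_max_le_left hn), ← hN' n (le_of_max_le_right hn)]

theorem eq_zero (h : IsGradingProj 𝒱 π) (x : V) (hx : ∀ j, π j x = 0) : x = 0 := by
  obtain ⟨N, hN⟩ := h.exists_sum x
  rw [hN N le_rfl]
  exact Finset.sum_eq_zero fun j _ => hx j

theorem isInternal (h : IsGradingProj 𝒱 π) : DirectSum.IsInternal 𝒱 := by
  refine DirectSum.isInternal_submodule_of_iSupIndep_of_iSup_eq_top (fun i => ?_) h.top
  refine Submodule.disjoint_def.2 fun x hx hx' => ?_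
  have hle : ⨆ j, ⨆ (_ : j ≠ i), 𝒱 j ≤ LinearMap.ker (π i) :=
    iSup₂_le fun j hj y hy => h.ne j i hj y hy
  rw [← h.self i x hx]
  exact hle hx'

theorem comm (h : IsGradingProj 𝒱 π) (h' : IsGradingProj 𝒲 ρ) (f : V →ₗ[k] W) (s : ℕ)
    (hf : ∀ j, ∀ x ∈ 𝒱 j, f x ∈ 𝒲 (j + s)) (j : ℕ) (x : V) :
    f (π j x) = ρ (j + s) (f x) := by
  induction x using h.induction with
  | hom i x hx =>
    by_cases hij : i = j
    · subst hij; rw [h.self i x hx, h'.self _ _ (hf i x hx)]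
    · rw [h.ne i j hij x hx, h'.ne (i + s) (j + s) (by omega) _ (hf i x hx), map_zero]
  | add x y hx hy => simp only [map_add, hx, hy]

/-- The preimage of a homogeneous element under an injective map of degree `1`. -/
theorem mem_of_injective (h : IsGradingProj 𝒱 π) (h' : IsGradingProj 𝒲 ρ) (f : V →ₗ[k] W)
    (hf : ∀ j, ∀ x ∈ 𝒱 j, f x ∈ 𝒲 (j + 1)) (hinj : Function.Injective f) (j : ℕ) (x : V)
    (hx : f x ∈ 𝒲 j) : x = 0 ∨ ∃ l, j = l + 1 ∧ x ∈ 𝒱 l := by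
  cases j with
  | zero =>
    refine Or.inl (h.eq_zero x fun l => hinj ?_)
    rw [h.comm h' f 1 hf, map_zero, h'.ne 0 (l + 1) (by omega) _ hx]
  | succ l =>
    refine Or.inr ⟨l, rfl, ?_⟩
    have : π l x = x := hinj (by rw [h.comm h' f 1 hf, h'.self _ _ hx])
    rw [← this]
    exact h.mem l x

/-- The induced grading of the quotient by a graded subspace. -/
theorem of_surjective (h : IsGradingProj 𝒱 π) (f : V →ₗ[k] W) (hf : Function.Surjective f)
    (hker : ∀ j, ∀ x, f x = 0 → f (π j x) = 0) :
    ∃ ρ : ℕ → W →ₗ[k] W, IsGradingProj (fun j => (𝒱 j).map f) ρ := by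
  have hle : ∀ j, LinearMap.ker f ≤ LinearMap.ker (f ∘ₗ π j) := fun j x hx => hker j x hx
  let e := f.quotKerEquivOfSurjective hf
  have he : ∀ j x, ((LinearMap.ker f).liftQ (f ∘ₗ π j) (hle j)) (e.symm (f x)) = f (π j x) := by
    intro j x
    have : e.symm (f x) = Submodule.Quotient.mk x := by
      rw [LinearEquiv.symm_apply_eq]; rfl
    rw [this]; rfl
  refine ⟨fun j => (LinearMap.ker f).liftQ (f ∘ₗ π j) (hle j) ∘ₗ e.symm.toLinearMap, ?_, ?_, ?_⟩
  · rintro j _ ⟨x, hx, rfl⟩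
    exact (he j x).trans (by rw [h.self j x hx])
  · rintro i j hij _ ⟨x, hx, rfl⟩
    exact (he j x).trans (by rw [h.ne i j hij x hx, map_zero])
  · rw [← Submodule.map_iSup, h.top, Submodule.map_top, LinearMap.range_eq_top.2 hf]

end IsGradingProj

/-- The grading of a tensor product. -/
theorem IsGradingProj.tensor {𝒱 : ℕ → Submodule k V} {π : ℕ → V →ₗ[k] V}
    {𝒲 : ℕ → Submodule k W} {ρ : ℕ → W →ₗ[k] W} (h : IsGradingProj 𝒱 π)
    (h' : IsGradingProj 𝒲 ρ) :
    IsGradingProj (V := V ⊗[k] W)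
      (fun j => ⨆ p ∈ Finset.HasAntidiagonal.antidiagonal j,
        Submodule.map₂ (TensorProduct.mk k V W) (𝒱 p.1) (𝒲 p.2))
      (fun j => ∑ p ∈ Finset.HasAntidiagonal.antidiagonal j,
        TensorProduct.map (π p.1) (ρ p.2)) := by
  refine ⟨fun j => ?_, fun i j hij => ?_, ?_⟩
  · have : (⨆ p ∈ Finset.HasAntidiagonal.antidiagonal j,
        Submodule.map₂ (TensorProduct.mk k V W) (𝒱 p.1) (𝒲 p.2)) ≤
        LinearMap.eqLocus (∑ p ∈ Finset.HasAntidiagonal.antidiagonal j,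
        TensorProduct.map (π p.1) (ρ p.2)) LinearMap.id := by
      refine iSup₂_le fun p hp => Submodule.map₂_le.2 fun x hx y hy => ?_
      simp only [LinearMap.mem_eqLocus, LinearMap.sum_apply, TensorProduct.mk_apply,
        TensorProduct.map_tmul, LinearMap.id_apply]
      rw [Finset.sum_eq_single p, h.self _ x hx, h'.self _ y hy]
      · intro q hq hqp
        rw [Finset.HasAntidiagonal.mem_antidiagonal] at hp hq
        -- Two pairs with the same sum and the same first entry coincide.
        have : p.1 ≠ q.1 := fun e => hqp (Prod.ext e.symm (by omega))
        rw [h.ne _ _ this x hx, TensorProduct.zero_tmul]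
      · exact fun hp' => absurd hp hp'
    exact fun x hx => this hx
  · have : (⨆ p ∈ Finset.HasAntidiagonal.antidiagonal i,
        Submodule.map₂ (TensorProduct.mk k V W) (𝒱 p.1) (𝒲 p.2)) ≤
        LinearMap.ker (∑ p ∈ Finset.HasAntidiagonal.antidiagonal j,
        TensorProduct.map (π p.1) (ρ p.2)) := by
      refine iSup₂_le fun p hp => Submodule.map₂_le.2 fun x hx y hy => ?_
      simp only [LinearMap.mem_ker, LinearMap.sum_apply, TensorProduct.mk_apply,
        TensorProduct.map_tmul]
      refine Finset.sum_eq_zero fun q hq => ?_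
      rw [Finset.HasAntidiagonal.mem_antidiagonal] at hp hq
      by_cases e : p.1 = q.1
      · rw [h'.ne p.2 q.2 (by omega) y hy, TensorProduct.tmul_zero]
      · rw [h.ne _ _ e x hx, TensorProduct.zero_tmul]
    exact fun x hx => this hx
  · rw [eq_top_iff, ← TensorProduct.map₂_mk_top_top_eq_top, ← h.top, ← h'.top,
      Submodule.map₂_iSup_left]
    simp_rw [Submodule.map₂_iSup_right]
    refine iSup_le fun p => iSup_le fun q => ?_
    refine le_iSup_of_le (p + q) ?_
    exact le_iSup₂_of_le (p, q) (Finset.HasAntidiagonal.mem_antidiagonal.2 rfl) le_rfl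

end Grading

/-! ### Functoriality of the bar complex -/

namespace Bar

variable {k : Type u} [Field k] {R M N P : Type w} [Ring R] [Algebra k R]
  [AddCommGroup M] [Module k M] [Module Rᵐᵒᵖ M] [IsScalarTower k Rᵐᵒᵖ M]
  [AddCommGroup N] [Module k N] [Module Rᵐᵒᵖ N] [IsScalarTower k Rᵐᵒᵖ N]
  [AddCommGroup P] [Module k P] [Module Rᵐᵒᵖ P] [IsScalarTower k Rᵐᵒᵖ P]

/-- The map `f ⊗ id ⊗ ⋯ ⊗ id`. -/
def map (f : M →ₗ[Rᵐᵒᵖ] N) : (n : ℕ) → (Obj k R M n →ₗ[k] Obj k R N n)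
  | 0 => f.restrictScalars k
  | n + 1 => LinearMap.rTensor R (map f n)

theorem map_tmul (f : M →ₗ[Rᵐᵒᵖ] N) (n : ℕ) (x : Obj k R M n) (r : R) :
    map f (n + 1) (tmul k R M n x r) = tmul k R N n (map f n x) r := rfl

theorem map_rightMul (f : M →ₗ[Rᵐᵒᵖ] N) (n : ℕ) (x : Obj k R M n) (r : R) :
    map f n (rightMul k R M n (x ⊗ₜ[k] r)) = rightMul k R N n (map f n x ⊗ₜ[k] r) := by
  cases n with
  | zero => exact f.map_smul (op r) x
  | succ n =>
    induction x using induction_tmul with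
    | h0 => simp
    | ht x s => rw [rightMul_succ_tmul, map_tmul, map_tmul, rightMul_succ_tmul]
    | ha x y hx hy => simp only [TensorProduct.add_tmul, map_add, hx, hy]

theorem map_resD (f : M →ₗ[Rᵐᵒᵖ] N) (n : ℕ) (x : Obj k R M (n + 1)) :
    map f n (resD k R M n x) = resD k R N n (map f (n + 1) x) := by
  induction n with
  | zero =>
    induction x using induction_tmul with
    | h0 => simp
    | ht x r => rw [resD_zero_tmul, map_rightMul, map_tmul, resD_zero_tmul]
    | ha x y hx hy => simp only [map_add, hx, hy]
  | succ n ih =>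
    induction x using induction_tmul with
    | h0 => simp
    | ht x r =>
      rw [resD_succ_tmul, map_add, map_smul, map_rightMul, map_tmul, map_tmul, resD_succ_tmul, ih]
    | ha x y hx hy => simp only [map_add, hx, hy]

theorem map_augLast (f : M →ₗ[Rᵐᵒᵖ] N) (ε : R →ₐ[k] k) (n : ℕ) (x : Obj k R M (n + 1)) :
    map f n (augLast M ε n x) = augLast N ε n (map f (n + 1) x) := by
  induction x using induction_tmul with
  | h0 => simp
  | ht x r => rw [augLast_tmul, map_smul, map_tmul, augLast_tmul]
  | ha x y hx hy => simp only [map_add, hx, hy]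

theorem map_d (f : M →ₗ[Rᵐᵒᵖ] N) (ε : R →ₐ[k] k) (n : ℕ) (x : Obj k R M (n + 1)) :
    map f n (d M ε n x) = d N ε n (map f (n + 1) x) := by
  simp only [d, LinearMap.add_apply, LinearMap.smul_apply, map_add, map_smul, map_resD,
    map_augLast]

/-- Tensoring over the field `k` is exact; this is what makes the bar complex an exact functor of
the module. -/
theorem map_injective (f : M →ₗ[Rᵐᵒᵖ] N) (hf : Function.Injective f) (n : ℕ) :
    Function.Injective (map (k := k) f n) := by
  induction n with
  | zero => exact hf
  | succ n ih => exact Module.Flat.rTensor_preserves_injective_linearMap _ ih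

theorem map_surjective (f : M →ₗ[Rᵐᵒᵖ] N) (hf : Function.Surjective f) (n : ℕ) :
    Function.Surjective (map (k := k) f n) := by
  induction n with
  | zero => exact hf
  | succ n ih => exact LinearMap.rTensor_surjective _ ih

theorem map_exact (f : M →ₗ[Rᵐᵒᵖ] N) (p : N →ₗ[Rᵐᵒᵖ] P) (hp : Function.Surjective p)
    (h : Function.Exact f p) (n : ℕ) :
    Function.Exact (map (k := k) f n) (map (k := k) p n) := by
  induction n with
  | zero => exact h
  | succ n ih => exact rTensor_exact R ih (map_surjective p hp n)

/-! ### The grading of the bar complex -/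

variable {𝒜 : ℕ → Submodule k R} {ℳ : ℕ → Submodule k M} {𝒩 : ℕ → Submodule k N}

@[elab_as_elim]
theorem objDeg_succ_induction {n j : ℕ} {p : Obj k R M (n + 1) → Prop}
    (x : Obj k R M (n + 1)) (hx : x ∈ objDeg 𝒜 ℳ (n + 1) j) (h0 : p 0)
    (ht : ∀ a b, a + b = j → ∀ x ∈ objDeg 𝒜 ℳ n a, ∀ r ∈ 𝒜 b, p (tmul k R M n x r))
    (ha : ∀ x y, p x → p y → p (x + y)) : p x := by
  refine Submodule.iSup_induction _ (motive := p) hx (fun q x hx => ?_) h0 ha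
  refine Submodule.iSup_induction _ (motive := p) hx (fun hq x hx => ?_) h0 ha
  rw [Finset.HasAntidiagonal.mem_antidiagonal] at hq
  -- `Submodule.map₂` is itself a supremum, indexed by the elements of its first argument.
  refine Submodule.iSup_induction _ (motive := p) hx (fun y x hx => ?_) h0 ha
  obtain ⟨r, hr, rfl⟩ := hx
  exact ht _ _ hq y y.2 r hr

theorem tmul_mem_objDeg {n a b j : ℕ} (h : a + b = j) {x : Obj k R M n}
    (hx : x ∈ objDeg 𝒜 ℳ n a) {r : R} (hr : r ∈ 𝒜 b) :
    tmul k R M n x r ∈ objDeg 𝒜 ℳ (n + 1) j :=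
  Submodule.mem_iSup_of_mem (a, b) (Submodule.mem_iSup_of_mem (Finset.HasAntidiagonal.mem_antidiagonal.2 h)
    (Submodule.apply_mem_map₂ _ hx hr))

theorem exists_isGradingProj {πR : ℕ → R →ₗ[k] R} (hR : IsGradingProj 𝒜 πR)
    {πM : ℕ → M →ₗ[k] M} (hM : IsGradingProj ℳ πM) (n : ℕ) :
    ∃ π : ℕ → Obj k R M n →ₗ[k] Obj k R M n, IsGradingProj (objDeg 𝒜 ℳ n) π := by
  induction n with
  | zero => exact ⟨πM, hM⟩
  | succ n ih =>
    obtain ⟨π, hπ⟩ := ih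
    exact ⟨_, hπ.tensor hR⟩

theorem map_mem_objDeg (f : M →ₗ[Rᵐᵒᵖ] N) (s : ℕ) (hf : ∀ j, ∀ x ∈ ℳ j, f x ∈ 𝒩 (j + s))
    (n : ℕ) : ∀ j, ∀ x ∈ objDeg 𝒜 ℳ n j, map f n x ∈ objDeg 𝒜 𝒩 n (j + s) := by
  induction n with
  | zero => exact hf
  | succ n ih =>
    intro j x hx
    refine objDeg_succ_induction x hx ?_ (fun a b hab x hx r hr => ?_)
      (fun x y hx hy => ?_)
    · rw [map_zero]; exact zero_mem _
    · rw [map_tmul]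
      exact tmul_mem_objDeg (by omega) (ih a x hx) hr
    · rw [map_add]; exact add_mem hx hy

/-- Lifts can be chosen in the same degree, so a homogeneous cycle of a quotient lifts to a
homogeneous chain. -/
theorem exists_map_eq_of_mem_objDeg (f : M →ₗ[Rᵐᵒᵖ] N)
    (hf : ∀ j, ∀ y ∈ 𝒩 j, ∃ x ∈ ℳ j, f x = y)
    (n : ℕ) : ∀ j, ∀ y ∈ objDeg 𝒜 𝒩 n j, ∃ x ∈ objDeg 𝒜 ℳ n j, map f n x = y := by
  induction n with
  | zero => exact hf
  | succ n ih =>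
    intro j y hy
    refine objDeg_succ_induction y hy ?_ (fun a b hab y hy r hr => ?_)
      (fun y y' hy hy' => ?_)
    · exact ⟨0, zero_mem _, map_zero _⟩
    · obtain ⟨x, hx, rfl⟩ := ih a y hy
      exact ⟨_, tmul_mem_objDeg hab hx hr, map_tmul f n x r⟩
    · obtain ⟨x, hx, rfl⟩ := hy
      obtain ⟨x', hx', rfl⟩ := hy'
      exact ⟨x + x', add_mem hx hx', map_add _ _ _⟩

theorem rightMul_mem_objDeg (h𝒜 : SetLike.GradedMonoid 𝒜)
    (hℳ : ∀ i j, ∀ m ∈ ℳ i, ∀ r ∈ 𝒜 j, op r • m ∈ ℳ (i + j)) (n a b : ℕ) (x : Obj k R M n)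
    (hx : x ∈ objDeg 𝒜 ℳ n a) (r : R) (hr : r ∈ 𝒜 b) :
    rightMul k R M n (x ⊗ₜ[k] r) ∈ objDeg 𝒜 ℳ n (a + b) := by
  cases n with
  | zero => exact hℳ a b x hx r hr
  | succ n =>
    refine objDeg_succ_induction x hx ?_ (fun a' b' hab x hx s hs => ?_)
      (fun x y hx hy => ?_)
    · rw [TensorProduct.zero_tmul, map_zero]; exact zero_mem _
    · rw [rightMul_succ_tmul]
      exact tmul_mem_objDeg (by omega) hx (h𝒜.mul_mem hs hr)
    · rw [TensorProduct.add_tmul, map_add]; exact add_mem hx hy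

theorem resD_mem_objDeg (h𝒜 : SetLike.GradedMonoid 𝒜)
    (hℳ : ∀ i j, ∀ m ∈ ℳ i, ∀ r ∈ 𝒜 j, op r • m ∈ ℳ (i + j)) (n : ℕ) :
    ∀ j, ∀ x ∈ objDeg 𝒜 ℳ (n + 1) j, resD k R M n x ∈ objDeg 𝒜 ℳ n j := by
  induction n with
  | zero =>
    intro j x hx
    refine objDeg_succ_induction x hx ?_ (fun a b hab x hx r hr => ?_)
      (fun x y hx hy => ?_)
    · rw [map_zero]; exact zero_mem _
    · rw [resD_zero_tmul, ← hab]
      exact rightMul_mem_objDeg h𝒜 hℳ 0 a b x hx r hr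
    · rw [map_add]; exact add_mem hx hy
  | succ n ih =>
    intro j x hx
    refine objDeg_succ_induction x hx ?_ (fun a b hab x hx r hr => ?_)
      (fun x y hx hy => ?_)
    · rw [map_zero]; exact zero_mem _
    · rw [resD_succ_tmul]
      refine add_mem (tmul_mem_objDeg hab (ih a x hx) hr) (Submodule.smul_mem _ _ ?_)
      rw [← hab]
      exact rightMul_mem_objDeg h𝒜 hℳ (n + 1) a b x hx r hr
    · rw [map_add]; exact add_mem hx hy

theorem augLast_mem_objDeg (ε : R →ₐ[k] k) (hε : ∀ n, 0 < n → ∀ r ∈ 𝒜 n, ε r = 0) (n : ℕ) :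
    ∀ j, ∀ x ∈ objDeg 𝒜 ℳ (n + 1) j, augLast M ε n x ∈ objDeg 𝒜 ℳ n j := by
  intro j x hx
  refine objDeg_succ_induction x hx ?_ (fun a b hab x hx r hr => ?_)
    (fun x y hx hy => ?_)
  · rw [map_zero]; exact zero_mem _
  · rw [augLast_tmul]
    rcases Nat.eq_zero_or_pos b with rfl | hb
    · rw [← hab]; exact Submodule.smul_mem _ _ hx
    · rw [hε b hb r hr, zero_smul]; exact zero_mem _
  · rw [map_add]; exact add_mem hx hy

theorem d_mem_objDeg (ε : R →ₐ[k] k) (h𝒜 : SetLike.GradedMonoid 𝒜)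
    (hε : ∀ n, 0 < n → ∀ r ∈ 𝒜 n, ε r = 0)
    (hℳ : ∀ i j, ∀ m ∈ ℳ i, ∀ r ∈ 𝒜 j, op r • m ∈ ℳ (i + j)) (n j : ℕ)
    (x : Obj k R M (n + 1)) (hx : x ∈ objDeg 𝒜 ℳ (n + 1) j) :
    d M ε n x ∈ objDeg 𝒜 ℳ n j :=
  add_mem (resD_mem_objDeg h𝒜 hℳ n j x hx)
    (Submodule.smul_mem _ _ (augLast_mem_objDeg ε hε n j x hx))

end Bar

namespace Bar

variable {k : Type u} [Field k] {R M N P : Type w} [Ring R] [Algebra k R]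
  [AddCommGroup M] [Module k M] [Module Rᵐᵒᵖ M] [IsScalarTower k Rᵐᵒᵖ M]
  [AddCommGroup N] [Module k N] [Module Rᵐᵒᵖ N] [IsScalarTower k Rᵐᵒᵖ N]
  [AddCommGroup P] [Module k P] [Module Rᵐᵒᵖ P] [IsScalarTower k Rᵐᵒᵖ P]

/-! ### Vanishing of graded components of the homology -/

variable (M) in
/-- The cycles of the bar complex. -/
def IsCycle (ε : R →ₐ[k] k) : (n : ℕ) → Obj k R M n → Prop
  | 0, _ => True
  | n + 1, x => d M ε n x = 0

/-- Every cycle of degree `j` in `M ⊗ R ⊗ ⋯ ⊗ R` (`i` factors `R`) is a boundary. -/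
def VanishesAt (ε : R →ₐ[k] k) (𝒜 : ℕ → Submodule k R) (ℳ : ℕ → Submodule k M) (i j : ℕ) : Prop :=
  ∀ x ∈ objDeg 𝒜 ℳ i j, IsCycle M ε i x → ∃ y, d M ε i y = x

theorem d_d_apply (ε : R →ₐ[k] k) (n : ℕ) (x : Obj k R M (n + 2)) :
    d M ε n (d M ε (n + 1) x) = 0 :=
  LinearMap.congr_fun (d_d (M := M) ε n) x

theorem isCycle_d (ε : R →ₐ[k] k) (n : ℕ) (x : Obj k R M (n + 1)) : IsCycle M ε n (d M ε n x) := by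
  cases n with
  | zero => trivial
  | succ n => exact d_d_apply ε n x

theorem isCycle_of_map (ε : R →ₐ[k] k) (f : M →ₗ[Rᵐᵒᵖ] N) (hf : Function.Injective f) (n : ℕ)
    (x : Obj k R M n) (hx : IsCycle N ε n (map f n x)) : IsCycle M ε n x := by
  cases n with
  | zero => trivial
  | succ n =>
    refine map_injective (k := k) f hf n ?_
    rw [map_d, map_zero]
    exact hx

/-- The part of the long exact homology sequence of `0 ⟶ M(-1) ⟶ N ⟶ P ⟶ 0` around `H_{i+1}(P)_j`:
if `H_{i+1}(N)_j` and `H_i(M)_{j-1}` vanish, then so does `H_{i+1}(P)_j`. -/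
theorem VanishesAt.of_shortExact {ε : R →ₐ[k] k} {𝒜 : ℕ → Submodule k R}
    {ℳ : ℕ → Submodule k M} {𝒩 : ℕ → Submodule k N} {𝒬 : ℕ → Submodule k P}
    {πR : ℕ → R →ₗ[k] R} (hR : IsGradingProj 𝒜 πR)
    {πM : ℕ → M →ₗ[k] M} (hM : IsGradingProj ℳ πM)
    {πN : ℕ → N →ₗ[k] N} (hN : IsGradingProj 𝒩 πN)
    (h𝒜 : SetLike.GradedMonoid 𝒜) (hε : ∀ n, 0 < n → ∀ r ∈ 𝒜 n, ε r = 0)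
    (hℳ : ∀ i j, ∀ m ∈ ℳ i, ∀ r ∈ 𝒜 j, op r • m ∈ ℳ (i + j))
    (h𝒩 : ∀ i j, ∀ m ∈ 𝒩 i, ∀ r ∈ 𝒜 j, op r • m ∈ 𝒩 (i + j))
    (f : M →ₗ[Rᵐᵒᵖ] N) (p : N →ₗ[Rᵐᵒᵖ] P) (hf : Function.Injective f)
    (hp : Function.Surjective p) (hfp : Function.Exact f p)
    (hfdeg : ∀ j, ∀ x ∈ ℳ j, f x ∈ 𝒩 (j + 1)) (hpdeg : ∀ j, ∀ y ∈ 𝒬 j, ∃ x ∈ 𝒩 j, p x = y)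
    {i j : ℕ} (h : VanishesAt ε 𝒜 𝒩 (i + 1) j)
    (h' : ∀ l, j = l + 1 → VanishesAt ε 𝒜 ℳ i l) :
    VanishesAt ε 𝒜 𝒬 (i + 1) j := by
  intro x hx hdx
  obtain ⟨y, hy, rfl⟩ := exists_map_eq_of_mem_objDeg p hpdeg (i + 1) j x hx
  have hdx' : d P ε i (map p (i + 1) y) = 0 := hdx
  have hfp' : ∀ n (z : Obj k R M n), map p n (map f n z) = 0 := fun n z =>
    (map_exact (k := k) f p hp hfp n _).2 ⟨z, rfl⟩
  -- The lift `y` of the given cycle need not be a cycle; it has to be corrected by a chain coming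
  -- from `M`, which `p` does not see.
  suffices H : ∃ y₀ : Obj k R M (i + 1), map f (i + 1) y₀ ∈ objDeg 𝒜 𝒩 (i + 1) j ∧
      d N ε i (map f (i + 1) y₀) = d N ε i y by
    obtain ⟨y₀, hy₀, hd⟩ := H
    have hc : d N ε i (y - map f (i + 1) y₀) = 0 := by rw [map_sub, hd, sub_self]
    obtain ⟨w, hw⟩ := h _ (sub_mem hy hy₀) hc
    refine ⟨map p (i + 2) w, ?_⟩
    rw [← map_d, hw, map_sub, hfp', sub_zero]
  rw [← map_d] at hdx'
  -- `z` represents the image of the class under the connecting homomorphism.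
  obtain ⟨z, hz⟩ := (map_exact (k := k) f p hp hfp i _).1 hdx'
  obtain ⟨π, hπ⟩ := exists_isGradingProj hR hM i
  obtain ⟨π', hπ'⟩ := exists_isGradingProj hR hM (i + 1)
  obtain ⟨ρ, hρ⟩ := exists_isGradingProj hR hN i
  have hdy : d N ε i y ∈ objDeg 𝒜 𝒩 i j := d_mem_objDeg ε h𝒜 hε h𝒩 i j y hy
  rcases hπ.mem_of_injective hρ (map f i) (map_mem_objDeg f 1 hfdeg i) (map_injective f hf i) j z
    (hz ▸ hdy) with rfl | ⟨l, rfl, hzl⟩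
  · exact ⟨0, by rw [map_zero]; exact zero_mem _, by rw [← hz]; simp⟩
  · obtain ⟨t, ht⟩ := h' l rfl z hzl (isCycle_of_map ε f hf i z (hz ▸ isCycle_d ε i y))
    -- The chain `t` bounding `z` need not be homogeneous, but its component of degree `l` still
    -- bounds `z`, since `d` preserves degrees.
    refine ⟨π' l t, map_mem_objDeg f 1 hfdeg (i + 1) l _ (hπ'.mem l t), ?_⟩
    have := hπ'.comm hπ (d M ε i) 0 (d_mem_objDeg ε h𝒜 hε hℳ i) l t
    rw [← map_d, this, ht, add_zero, hπ.self l z hzl, hz]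

/-! ### The contraction of the bar complex of a free module of rank one -/

variable (m₀ : Obj k R M 0) (e : M →ₗ[Rᵐᵒᵖ] R)

/-- The contraction `m₀ r₀ ⊗ r₁ ⊗ ⋯ ⊗ rₙ ↦ m₀ ⊗ r₀ ⊗ r₁ ⊗ ⋯ ⊗ rₙ`. -/
def contract : (n : ℕ) → (Obj k R M n →ₗ[k] Obj k R M (n + 1))
  | 0 => tmul k R M 0 m₀ ∘ₗ e.restrictScalars k
  | n + 1 => LinearMap.rTensor R (contract n)

theorem contract_tmul (n : ℕ) (x : Obj k R M n) (r : R) :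
    contract m₀ e (n + 1) (tmul k R M n x r) = tmul k R M (n + 1) (contract m₀ e n x) r := rfl

theorem contract_zero (x : Obj k R M 0) :
    contract m₀ e 0 x = tmul k R M 0 m₀ (e x) := rfl

theorem contract_rightMul (n : ℕ) (x : Obj k R M n) (r : R) :
    contract m₀ e n (rightMul k R M n (x ⊗ₜ[k] r))
      = rightMul k R M (n + 1) (contract m₀ e n x ⊗ₜ[k] r) := by
  cases n with
  | zero =>
    rw [contract_zero, contract_zero, rightMul_succ_tmul]
    exact congrArg _ (e.map_smul (op r) x)
  | succ n =>
    induction x using induction_tmul with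
    | h0 => simp
    | ht x s => rw [rightMul_succ_tmul, contract_tmul, contract_tmul, rightMul_succ_tmul]
    | ha x y hx hy => simp only [TensorProduct.add_tmul, map_add, hx, hy]

variable {m₀ e} in
theorem resD_contract_zero (he : ∀ m : M, rightMul k R M 0 (m₀ ⊗ₜ[k] e m) = m) (x : Obj k R M 0) :
    resD k R M 0 (contract m₀ e 0 x) = x := he x

-- The hypothesis `he` makes `m₀` a generator with coordinate `e`. Prepending `m₀` gives back `x` as
-- the first face and shifts every other face by one slot, which reverses its sign: a contracting
-- homotopy.
variable {m₀ e} in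
theorem resD_contract_succ (he : ∀ m : M, rightMul k R M 0 (m₀ ⊗ₜ[k] e m) = m) (n : ℕ) (x : Obj k R M (n + 1)) :
    resD k R M (n + 1) (contract m₀ e (n + 1) x) = x - contract m₀ e n (resD k R M n x) := by
  induction n with
  | zero =>
    induction x using induction_tmul with
    | h0 => simp
    | ht x r =>
      rw [contract_tmul, resD_succ_tmul, resD_contract_zero he, resD_zero_tmul, contract_rightMul]
      module
    | ha x y hx hy => simp only [map_add, hx, hy]; abel
  | succ n ih =>
    induction x using induction_tmul with
    | h0 => simp
    | ht x r =>
      rw [contract_tmul, resD_succ_tmul, ih, resD_succ_tmul, map_add, map_smul, contract_tmul,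
        contract_rightMul, map_sub, LinearMap.sub_apply, pow_succ _ (n + 1)]
      module
    | ha x y hx hy => simp only [map_add, hx, hy]; abel

/-- The two maps act on opposite ends of the tensor. In the lowest degree they would meet in the
same factor, which is why only the higher homology is contracted. -/
theorem augLast_contract (ε : R →ₐ[k] k) (n : ℕ) (x : Obj k R M (n + 1)) :
    augLast M ε (n + 1) (contract m₀ e (n + 1) x) = contract m₀ e n (augLast M ε n x) := by
  induction x using induction_tmul with
  | h0 => simp
  | ht x r => rw [contract_tmul, augLast_tmul, augLast_tmul, map_smul]
  | ha x y hx hy => simp only [map_add, hx, hy]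

variable {m₀ e} in
theorem d_contract (he : ∀ m : M, rightMul k R M 0 (m₀ ⊗ₜ[k] e m) = m) (ε : R →ₐ[k] k) (n : ℕ) (x : Obj k R M (n + 1)) :
    d M ε (n + 1) (contract m₀ e (n + 1) x) = x - contract m₀ e n (d M ε n x) := by
  simp only [d, LinearMap.add_apply, LinearMap.smul_apply, map_add, map_smul,
    resD_contract_succ he, augLast_contract, pow_succ _ (n + 1)]
  module

/-- The higher homology of a free module of rank one vanishes. -/
theorem vanishesAt_of_free (he : ∀ m : M, rightMul k R M 0 (m₀ ⊗ₜ[k] e m) = m) (ε : R →ₐ[k] k)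
    (𝒜 : ℕ → Submodule k R) (ℳ : ℕ → Submodule k M) (i j : ℕ) :
    VanishesAt ε 𝒜 ℳ (i + 1) j := by
  intro x _ hx
  have hx' : d M ε i x = 0 := hx
  exact ⟨contract m₀ e (i + 1) x, by rw [d_contract he, hx', map_zero, sub_zero]⟩

end Bar

/-! ### From explicit cycles and boundaries to the homology of the complex -/

section Homology

variable {k : Type u} [Field k] {R M : Type w} [Ring R] [Algebra k R] [AddCommGroup M]
  [Module k M] [Module Rᵐᵒᵖ M] [IsScalarTower k Rᵐᵒᵖ M]

open CategoryTheory

theorem Bar.complex_d_hom (ε : R →ₐ[k] k) (n : ℕ) :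
    (Bar.complex M ε).d (n + 1) n = ModuleCat.ofHom (Bar.d M ε n) :=
  ChainComplex.of_d (Bar.Obj k R M) (fun n => ModuleCat.ofHom (Bar.d M ε n)) n

theorem Bar.d_iCycles (ε : R →ₐ[k] k) (i : ℕ) (z : (Bar.complex M ε).cycles i) :
    Bar.IsCycle M ε i (((Bar.complex M ε).iCycles i).hom z) := by
  cases i with
  | zero => trivial
  | succ i =>
    have h := (Bar.complex M ε).iCycles_d (i + 1) i
    rw [Bar.complex_d_hom] at h
    exact LinearMap.congr_fun (congrArg ModuleCat.Hom.hom h) z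

theorem Bar.homologyπ_eq_zero (ε : R →ₐ[k] k) (i : ℕ) (z : (Bar.complex M ε).cycles i)
    (y : Bar.Obj k R M (i + 1)) (hy : Bar.d M ε i y = ((Bar.complex M ε).iCycles i).hom z) :
    ((Bar.complex M ε).homologyπ i).hom z = 0 := by
  have h1 : ((Bar.complex M ε).toCycles (i + 1) i).hom y = z := by
    apply (ModuleCat.mono_iff_injective ((Bar.complex M ε).iCycles i)).1 inferInstance
    have h := (Bar.complex M ε).toCycles_i (i + 1) i
    rw [Bar.complex_d_hom] at h
    exact (LinearMap.congr_fun (congrArg ModuleCat.Hom.hom h) y).trans hy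
  rw [← h1]
  exact LinearMap.congr_fun (congrArg ModuleCat.Hom.hom
    ((Bar.complex M ε).toCycles_comp_homologyπ (i + 1) i)) y

theorem algHomologyDeg_eq_bot {ε : R →ₐ[k] k} {𝒜 : ℕ → Submodule k R} {ℳ : ℕ → Submodule k M}
    {i j : ℕ} (h : Bar.VanishesAt ε 𝒜 ℳ i j) : algHomologyDeg ε 𝒜 ℳ i j = ⊥ := by
  rw [eq_bot_iff]
  rintro _ ⟨z, hz, rfl⟩
  obtain ⟨y, hy⟩ := h _ hz (Bar.d_iCycles ε i z)
  exact Bar.homologyπ_eq_zero ε i z y hy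

/-- A grading of the bar complex induces a grading of its homology. -/
theorem algHomologyDeg_isInternal (ε : R →ₐ[k] k) {𝒜 : ℕ → Submodule k R}
    {ℳ : ℕ → Submodule k M} {πR : ℕ → R →ₗ[k] R} (hR : IsGradingProj 𝒜 πR)
    {πM : ℕ → M →ₗ[k] M} (hM : IsGradingProj ℳ πM)
    (h𝒜 : SetLike.GradedMonoid 𝒜) (hε : ∀ n, 0 < n → ∀ r ∈ 𝒜 n, ε r = 0)
    (hℳ : ∀ i j, ∀ m ∈ ℳ i, ∀ r ∈ 𝒜 j, op r • m ∈ ℳ (i + j)) (i : ℕ) :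
    DirectSum.IsInternal (algHomologyDeg ε 𝒜 ℳ i) := by
  choose π hπ using fun n => Bar.exists_isGradingProj (M := M) hR hM n
  have hd : ∀ n j x, Bar.d M ε n (π (n + 1) j x) = π n j (Bar.d M ε n x) := fun n j x =>
    (hπ (n + 1)).comm (hπ n) (Bar.d M ε n) 0 (Bar.d_mem_objDeg ε h𝒜 hε hℳ n) j x
  -- The projections onto degree `j` commute with the differential, so they are chain maps; the maps
  -- they induce on homology serve as its projections.
  let φ : ℕ → (Bar.complex M ε ⟶ Bar.complex M ε) := fun j =>
    { f := fun n => ModuleCat.ofHom (π n j)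
      comm' := fun a b hab => by
        obtain rfl : b + 1 = a := hab
        rw [Bar.complex_d_hom]
        exact ModuleCat.hom_ext (LinearMap.ext fun x => hd b j x) }
  have hφi : ∀ j (z : (Bar.complex M ε).cycles i),
      ((Bar.complex M ε).iCycles i).hom ((HomologicalComplex.cyclesMap (φ j) i).hom z)
        = π i j (((Bar.complex M ε).iCycles i).hom z) := fun j z =>
    LinearMap.congr_fun (congrArg ModuleCat.Hom.hom (HomologicalComplex.cyclesMap_i (φ j) i)) z
  have hφπ : ∀ j (z : (Bar.complex M ε).cycles i),
      (HomologicalComplex.homologyMap (φ j) i).hom (((Bar.complex M ε).homologyπ i).hom z)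
        = ((Bar.complex M ε).homologyπ i).hom ((HomologicalComplex.cyclesMap (φ j) i).hom z) :=
    fun j z => LinearMap.congr_fun (congrArg ModuleCat.Hom.hom
      (HomologicalComplex.homologyπ_naturality (φ j) i)) z
  have hinj : Function.Injective ((Bar.complex M ε).iCycles i).hom :=
    (ModuleCat.mono_iff_injective ((Bar.complex M ε).iCycles i)).1 inferInstance
  have hsurj : Function.Surjective ((Bar.complex M ε).homologyπ i).hom :=
    (ModuleCat.epi_iff_surjective ((Bar.complex M ε).homologyπ i)).1 inferInstance
  refine IsGradingProj.isInternal
    (π := fun j => (HomologicalComplex.homologyMap (φ j) i).hom) ⟨?_, ?_, ?_⟩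
  · rintro j _ ⟨z, hz, rfl⟩
    rw [hφπ]
    congr 1
    apply hinj
    rw [hφi, (hπ i).self j _ hz]
  · rintro j j' hj _ ⟨z, hz, rfl⟩
    rw [hφπ]
    have : (HomologicalComplex.cyclesMap (φ j') i).hom z = 0 := by
      apply hinj
      exact (hφi j' z).trans (((hπ i).ne j j' hj _ hz).trans (map_zero _).symm)
    rw [this, map_zero]
  · rw [eq_top_iff]
    rintro x -
    obtain ⟨z, rfl⟩ := hsurj x
    obtain ⟨n, hn⟩ := (hπ i).exists_sum (((Bar.complex M ε).iCycles i).hom z)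
    -- The homogeneous components of a cycle are again cycles.
    have hz : z = ∑ j ∈ Finset.range n, (HomologicalComplex.cyclesMap (φ j) i).hom z := by
      apply hinj
      rw [map_sum]
      simp only [hφi]
      exact hn n le_rfl
    rw [hz, map_sum]
    refine sum_mem fun j _ => Submodule.mem_iSup_of_mem j ⟨_, ?_, rfl⟩
    change ((Bar.complex M ε).iCycles i).hom ((HomologicalComplex.cyclesMap (φ j) i).hom z)
      ∈ Bar.objDeg 𝒜 ℳ i j
    rw [hφi]
    exact (hπ i).mem j _

end Homology

/-! ### Skew-commuting generators and their monomials -/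

namespace SkewMonomial

variable {k : Type*} [Field k] {ι : Type*} [DecidableEq ι] (q : ι → ι → k)

/-- The scalar `c` with `x i * x ^ a = c • x ^ (a + eᵢ)`, for the monomials `x ^ a` ordered
along the list. -/
def coef (i : ι) (a : ι → ℕ) : List ι → k
  | [] => 1
  | j :: l => if j = i then 1 else q i j ^ a j * coef i a l

open Classical in
/-- The left multiplication by the generator `x i` on the monomials;
the square of `x i` is `0` unless `q i i = 1`. -/
def mulGen (l : List ι) (i : ι) : ((ι → ℕ) →₀ k) →ₗ[k] ((ι → ℕ) →₀ k) :=
  Finsupp.linearCombination k fun a =>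
    if q i i ≠ 1 ∧ 0 < a i then 0 else Finsupp.single (a + Pi.single i 1) (coef q i a l)

variable {q}

theorem coef_ne_zero (hq : ∀ i j, q i j * q j i = 1) (i : ι) (a : ι → ℕ) (l : List ι) :
    coef q i a l ≠ 0 := by
  induction l with
  | nil => exact one_ne_zero
  | cons j l ih =>
    rw [coef]
    split_ifs
    · exact one_ne_zero
    · exact mul_ne_zero (pow_ne_zero _ (left_ne_zero_of_mul_eq_one (hq i j))) ih

theorem coef_add_of_notMem (i j : ι) (a : ι → ℕ) (l : List ι) (hj : j ∉ l) :
    coef q i (a + Pi.single j 1) l = coef q i a l := by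
  induction l with
  | nil => rfl
  | cons h l ih =>
    rw [List.mem_cons, not_or] at hj
    rw [coef, coef, ih hj.2, Pi.add_apply, Pi.single_eq_of_ne (Ne.symm hj.1), add_zero]

/-- Letters other than `i` and `j` contribute equally to both sides. Whichever of the two comes
first in the list is crossed once more by the other when it has already been inserted, and this
gives the factor `q i j` or its inverse. -/
theorem coef_comm (hq : ∀ i j, q i j * q j i = 1) {i j : ι} (hij : i ≠ j) (a : ι → ℕ)
    (l : List ι) (hl : l.Nodup) (hi : i ∈ l) (hj : j ∈ l) :
    coef q i (a + Pi.single j 1) l * coef q j a l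
      = q i j * (coef q j (a + Pi.single i 1) l * coef q i a l) := by
  induction l with
  | nil => exact absurd hi List.not_mem_nil
  | cons h l ih =>
    rw [List.nodup_cons] at hl
    by_cases hhi : h = i
    · subst hhi
      simp only [coef, if_true, if_neg hij, coef_add_of_notMem _ _ _ _ hl.1, Pi.add_apply,
        Pi.single_eq_same, pow_succ, one_mul, mul_one]
      linear_combination (-(q j h ^ a h * coef q j a l)) * hq h j
    · by_cases hhj : h = j
      · subst hhj
        simp only [coef, if_true, if_neg hhi, coef_add_of_notMem _ _ _ _ hl.1, Pi.add_apply,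
          Pi.single_eq_same, pow_succ, one_mul, mul_one]
        ring
      · have hi' : i ∈ l := (List.mem_cons.1 hi).resolve_left (Ne.symm hhi)
        have hj' : j ∈ l := (List.mem_cons.1 hj).resolve_left (Ne.symm hhj)
        simp only [coef, if_neg hhi, if_neg hhj, Pi.add_apply, Pi.single_eq_of_ne hhi,
          Pi.single_eq_of_ne hhj, add_zero]
        linear_combination (q i h ^ a h * q j h ^ a h) * ih hl.2 hi' hj'

theorem mulGen_single_of (l : List ι) (i : ι) (a : ι → ℕ) (c : k) (h : q i i ≠ 1 ∧ 0 < a i) :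
    mulGen q l i (Finsupp.single a c) = 0 := by
  rw [mulGen, Finsupp.linearCombination_single, if_pos h, smul_zero]

theorem mulGen_single_of_not (l : List ι) (i : ι) (a : ι → ℕ) (c : k)
    (h : ¬ (q i i ≠ 1 ∧ 0 < a i)) :
    mulGen q l i (Finsupp.single a c)
      = Finsupp.single (a + Pi.single i 1) (c * coef q i a l) := by
  rw [mulGen, Finsupp.linearCombination_single, if_neg h, Finsupp.smul_single, smul_eq_mul]

/-- These are the defining relations of the algebra, so they yield the action on monomials. For `i ≠
j` the test for being killed by one generator ignores the exponent of the other. -/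
theorem mulGen_comm (hq : ∀ i j, q i j * q j i = 1) (l : List ι) (hl : l.Nodup)
    (hmem : ∀ i, i ∈ l) (i j : ι) :
    mulGen q l i * mulGen q l j = q i j • (mulGen q l j * mulGen q l i) := by
  refine Finsupp.lhom_ext fun a c => ?_
  simp only [Module.End.mul_apply, LinearMap.smul_apply]
  by_cases hij : i = j
  · subst hij
    by_cases h1 : q i i = 1
    · rw [h1, one_smul]
    -- For `q i i ≠ 1` the relation forces the square to be zero, which the truncation in `mulGen`
    -- guarantees.
    · have h0 : mulGen q l i (mulGen q l i (Finsupp.single a c)) = 0 := by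
        by_cases h : q i i ≠ 1 ∧ 0 < a i
        · rw [mulGen_single_of l i a c h, map_zero]
        · rw [mulGen_single_of_not l i a c h, mulGen_single_of]
          exact ⟨h1, by simp⟩
      rw [h0, smul_zero]
  · have hji : (a + Pi.single j 1 : ι → ℕ) i = a i := by simp [hij]
    have hij' : (a + Pi.single i 1 : ι → ℕ) j = a j := by
      simp [Ne.symm hij]
    by_cases h : q i i ≠ 1 ∧ 0 < a i
    · rw [mulGen_single_of l i a c h, map_zero, smul_zero]
      by_cases h' : q j j ≠ 1 ∧ 0 < a j
      · rw [mulGen_single_of l j a c h', map_zero]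
      · rw [mulGen_single_of_not l j a c h', mulGen_single_of]
        rwa [hji]
    · rw [mulGen_single_of_not l i a c h]
      by_cases h' : q j j ≠ 1 ∧ 0 < a j
      · rw [mulGen_single_of l j a c h', map_zero, mulGen_single_of, smul_zero]
        rwa [hij']
      · rw [mulGen_single_of_not l j a c h', mulGen_single_of_not, mulGen_single_of_not,
          Finsupp.smul_single, add_right_comm, smul_eq_mul]
        · congr 1
          linear_combination c * coef_comm hq hij a l hl (hmem i) (hmem j)
        · rwa [hij']
        · rwa [hji]

/-- Raising the `i`-th exponent is injective on exponents, so the coefficient at `a + eᵢ` has no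
contribution other than from `a`. -/
theorem mulGen_apply (l : List ι) (i : ι) (v : (ι → ℕ) →₀ k) (a : ι → ℕ)
    (h : ¬ (q i i ≠ 1 ∧ 0 < a i)) :
    mulGen q l i v (a + Pi.single i 1) = v a * coef q i a l := by
  induction v using Finsupp.induction_linear with
  | zero => simp
  | add v w hv hw => 
    rw [map_add (mulGen q l i), Finsupp.add_apply, hv, hw, Finsupp.add_apply, add_mul]
  | single b c =>
    by_cases hb : b = a
    · subst hb
      rw [mulGen_single_of_not l i b c h, Finsupp.single_eq_same, Finsupp.single_eq_same]
    · rw [Finsupp.single_eq_of_ne (Ne.symm hb), zero_mul]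
      by_cases h' : q i i ≠ 1 ∧ 0 < b i
      · rw [mulGen_single_of l i b c h', Finsupp.zero_apply]
      · rw [mulGen_single_of_not l i b c h', Finsupp.single_eq_of_ne]
        exact fun e => hb (add_right_cancel e).symm

variable {A : Type*} [Ring A] [Algebra k A] (x : ι → A)

/-- The monomial with exponents `a`, ordered along the list. -/
def mono (a : ι → ℕ) (l : List ι) : A := (l.map fun j => x j ^ a j).prod

theorem mono_add_of_notMem (i : ι) (a : ι → ℕ) (l : List ι) (hi : i ∉ l) :
    mono x (a + Pi.single i 1) l = mono x a l := by
  rw [mono, mono]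
  congr 1
  refine List.map_congr_left fun j hj => ?_
  have hji : j ≠ i := fun e => hi (e ▸ hj)
  rw [Pi.add_apply, Pi.single_eq_of_ne hji, add_zero]

variable {x}

theorem mul_pow_skew (h : ∀ i j, x i * x j = q i j • (x j * x i)) (i j : ι) (n : ℕ) :
    x i * x j ^ n = q i j ^ n • (x j ^ n * x i) := by
  induction n with
  | zero => simp
  | succ n ih =>
    rw [pow_succ, ← mul_assoc, ih, smul_mul_assoc, mul_assoc, h i j, mul_smul_comm, smul_smul,
      ← mul_assoc, pow_succ]

/-- The scalar is the one built into `mulGen`, so evaluation of formal monomials turns `mulGen` into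
genuine multiplication. -/
theorem gen_mul_mono (h : ∀ i j, x i * x j = q i j • (x j * x i)) (i : ι) (a : ι → ℕ)
    (l : List ι) (hl : l.Nodup) (hi : i ∈ l) :
    x i * mono x a l = coef q i a l • mono x (a + Pi.single i 1) l := by
  induction l with
  | nil => exact absurd hi List.not_mem_nil
  | cons j l ih =>
    rw [List.nodup_cons] at hl
    have hc : ∀ b : ι → ℕ, mono x b (j :: l) = x j ^ b j * mono x b l := fun b => by
      simp only [mono, List.map_cons, List.prod_cons]
    rw [hc, hc]
    by_cases hij : j = i
    · subst hij
      rw [coef, if_pos rfl, one_smul, mono_add_of_notMem x j a l hl.1, ← mul_assoc, ← pow_succ']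
      simp
    · rw [coef, if_neg hij, ← mul_assoc, mul_pow_skew h, smul_mul_assoc, mul_assoc,
        ih hl.2 ((List.mem_cons.1 hi).resolve_left (Ne.symm hij)), mul_smul_comm, smul_smul,
        Pi.add_apply, Pi.single_eq_of_ne hij, add_zero]

/-- The relation for `i = j` reads `(1 - q i i) • x i ^ 2 = 0`. -/
theorem gen_mul_gen (h : ∀ i j, x i * x j = q i j • (x j * x i)) (i : ι) (hi : q i i ≠ 1) :
    x i * x i = 0 := by
  have h0 : (1 - q i i) • (x i * x i) = 0 := by rw [sub_smul, one_smul, ← h i i, sub_self]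
  exact (smul_eq_zero.1 h0).resolve_left (sub_ne_zero.2 (Ne.symm hi))

theorem mono_eq_zero (h : ∀ i j, x i * x j = q i j • (x j * x i)) (i : ι) (hi : q i i ≠ 1)
    (a : ι → ℕ) (ha : 2 ≤ a i) (l : List ι) (hl : i ∈ l) : mono x a l = 0 := by
  refine List.prod_eq_zero (List.mem_map.2 ⟨i, hl, ?_⟩)
  obtain ⟨n, hn⟩ := Nat.exists_eq_add_of_le ha
  rw [hn, pow_add, pow_two, gen_mul_gen h i hi, zero_mul]

end SkewMonomial

/-! ### Algebras acting on the space of monomials -/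

open SkewMonomial

/-- `A` is generated by skew-commuting elements `x i` and acts on the space of monomials. -/
structure IsSkewPolynomial {k : Type*} [Field k] {ι : Type*} [DecidableEq ι] [Fintype ι]
    (q : ι → ι → k) {A : Type*} [Ring A] [Algebra k A] (x : ι → A) (l : List ι)
    (Φ : A →ₐ[k] Module.End k ((ι → ℕ) →₀ k)) : Prop where
  q_mul : ∀ i j, q i j * q j i = 1
  nodup : l.Nodup
  mem : ∀ i, i ∈ l
  skew : ∀ i j, x i * x j = q i j • (x j * x i)
  adjoin : Algebra.adjoin k (Set.range x) = ⊤
  act : ∀ i, Φ (x i) = mulGen q l i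

namespace IsSkewPolynomial

variable {k : Type*} [Field k] {ι : Type*} [DecidableEq ι] [Fintype ι]
  {q : ι → ι → k} {A : Type*} [Ring A] [Algebra k A] {x : ι → A} {l : List ι}
  {Φ : A →ₐ[k] Module.End k ((ι → ℕ) →₀ k)}

variable (x l) in
/-- The evaluation of a combination of monomials. -/
def eval : ((ι → ℕ) →₀ k) →ₗ[k] A := Finsupp.linearCombination k fun a => mono x a l

variable (Φ) in
/-- The coefficients of an element of `A` with respect to the monomials. -/
def coeffs : A →ₗ[k] ((ι → ℕ) →₀ k) := LinearMap.flip Φ.toLinearMap (Finsupp.single 0 1)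

theorem coeffs_apply (r : A) : coeffs Φ r = Φ r (Finsupp.single 0 1) := rfl

theorem eval_single (a : ι → ℕ) (c : k) :
    eval x l (Finsupp.single a c) = c • mono x a l :=
  Finsupp.linearCombination_single _ _ _

theorem mono_mem_pow (a : ι → ℕ) (l : List ι) :
    ∃ n, mono x a l ∈ Submodule.span k (Set.range x) ^ n := by
  induction l with
  | nil => exact ⟨0, by rw [pow_zero]; exact Submodule.one_le.1 le_rfl⟩
  | cons j l ih =>
    obtain ⟨n, hn⟩ := ih
    refine ⟨a j + n, ?_⟩
    rw [pow_add, mono, List.map_cons, List.prod_cons]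
    have hj : x j ∈ Submodule.span k (Set.range x) := Submodule.subset_span ⟨j, rfl⟩
    exact Submodule.mul_mem_mul (Submodule.pow_mem_pow _ hj _) hn

variable (H : IsSkewPolynomial q x l Φ)
include H

theorem eval_mulGen (i : ι) (v : (ι → ℕ) →₀ k) :
    eval x l (mulGen q l i v) = x i * eval x l v := by
  induction v using Finsupp.induction_linear with
  | zero => simp
  | add v w hv hw => rw [map_add, map_add, hv, hw, map_add, mul_add]
  | single a c =>
    rw [eval_single, mul_smul_comm, gen_mul_mono H.skew i a l H.nodup (H.mem i)]
    by_cases h : q i i ≠ 1 ∧ 0 < a i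
    · rw [mulGen_single_of l i a c h, map_zero, mono_eq_zero H.skew i h.1 _ _ l (H.mem i),
        smul_zero, smul_zero]
      simp only [Pi.add_apply, Pi.single_eq_same]
      omega
    · rw [mulGen_single_of_not l i a c h, eval_single, smul_smul]

theorem eval_act (r : A) (v : (ι → ℕ) →₀ k) : eval x l (Φ r v) = r * eval x l v := by
  have hr : r ∈ Algebra.adjoin k (Set.range x) := H.adjoin ▸ Algebra.mem_top
  induction hr using Algebra.adjoin_induction generalizing v with
  | mem y hy =>
    obtain ⟨i, rfl⟩ := hy
    rw [H.act, H.eval_mulGen]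
  | algebraMap c =>
    rw [AlgHom.commutes, Module.algebraMap_end_apply, map_smul, Algebra.smul_def]
  | add y z _ _ hy hz => rw [map_add, LinearMap.add_apply, map_add, hy, hz, add_mul]
  | mul y z _ _ hy hz => rw [map_mul, Module.End.mul_apply, hy, hz, mul_assoc]

/-- Evaluation intertwines the action with left multiplication; applying this to the monomial `1`
shows that an element is determined by its coefficients. -/
theorem eval_coeffs (r : A) : eval x l (coeffs Φ r) = r := by
  rw [coeffs_apply, H.eval_act, eval_single, one_smul, mono]
  simp

/-! ### Ideals generated by some of the generators -/

theorem coeffs_mem_supported (S : Set ι) (r : A) (hr : r ∈ Submodule.span Aᵐᵒᵖ (x '' S)) :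
    coeffs Φ r ∈ Finsupp.supported k k {a : ι → ℕ | ∃ s ∈ S, 0 < a s} := by
  -- A product `y * b` acts as `b` followed by `y`, so closure under right multiplication needs
  -- arbitrary vectors in place of the monomial `1`.
  suffices h : ∀ v, Φ r v ∈ Finsupp.supported k k {a : ι → ℕ | ∃ s ∈ S, 0 < a s} from h _
  induction hr using Submodule.span_induction with
  | mem y hy =>
    obtain ⟨s, hs, rfl⟩ := hy
    intro v
    rw [H.act]
    induction v using Finsupp.induction_linear with
    | zero => rw [map_zero]; exact zero_mem _
    | add v w hv hw => rw [map_add]; exact add_mem hv hw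
    | single a c =>
      by_cases h : q s s ≠ 1 ∧ 0 < a s
      · rw [mulGen_single_of l s a c h]; exact zero_mem _
      · rw [mulGen_single_of_not l s a c h]
        exact Finsupp.single_mem_supported k _ ⟨s, hs, by simp⟩
  | zero => intro v; rw [map_zero]; exact zero_mem _
  | add y z _ _ hy hz => intro v; rw [map_add]; exact add_mem (hy v) (hz v)
  | smul b y _ hy =>
    intro v
    have : Φ (b • y) v = Φ y (Φ (unop b) v) := by
      rw [← Module.End.mul_apply, ← map_mul]; rfl
    rw [this]
    exact hy _

theorem eval_mem_span (S : Set ι) (v : (ι → ℕ) →₀ k)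
    (hv : v ∈ Finsupp.supported k k {a : ι → ℕ | ∃ s ∈ S, 0 < a s}) :
    eval x l v ∈ Submodule.span Aᵐᵒᵖ (x '' S) := by
  rw [eval, Finsupp.linearCombination_apply, Finsupp.sum]
  refine sum_mem fun a ha => Submodule.smul_of_tower_mem _ _ ?_
  obtain ⟨s, hs, has⟩ := hv ha
  have hsub : a - Pi.single s 1 + Pi.single s 1 = a := by
    funext j
    by_cases hj : j = s
    · subst hj; simp; omega
    · simp [Pi.single_eq_of_ne hj]
  have h := gen_mul_mono H.skew s (a - Pi.single s 1) l H.nodup (H.mem s)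
  rw [hsub] at h
  -- A monomial involving `x s` is, up to a nonzero scalar, `x s` times the monomial with that
  -- exponent lowered by one; hence it lies in the right ideal.
  rw [← inv_smul_smul₀ (coef_ne_zero H.q_mul s (a - Pi.single s 1) l) (mono x a l), ← h]
  exact Submodule.smul_of_tower_mem _ _
    (Submodule.smul_mem _ (op _) (Submodule.subset_span ⟨s, hs, rfl⟩))

/-- Multiplication by `x i` either kills a monomial, when `q i i ≠ 1` and `x i` already occurs, or
sends it to a nonzero multiple of a monomial with the same exponents at every `s ≠ i`. Distinct
surviving monomials have distinct images, so nothing cancels. -/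
theorem gen_mul_mem_iff (S : Set ι) (i : ι) (hi : i ∉ S) (r : A) :
    x i * r ∈ Submodule.span Aᵐᵒᵖ (x '' S) ↔
      r ∈ Submodule.span Aᵐᵒᵖ (x '' (S ∪ {j | j = i ∧ q i i ≠ 1})) := by
  constructor
  · intro hr
    rw [← H.eval_coeffs r]
    refine H.eval_mem_span _ _ fun a ha => ?_
    have h := H.coeffs_mem_supported S _ hr
    rw [coeffs_apply, map_mul, Module.End.mul_apply, H.act, ← coeffs_apply] at h
    by_cases hai : q i i ≠ 1 ∧ 0 < a i
    · exact ⟨i, Or.inr ⟨rfl, hai.1⟩, hai.2⟩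
    · have hne : mulGen q l i (coeffs Φ r) (a + Pi.single i 1) ≠ 0 := by
        rw [mulGen_apply l i _ a hai]
        exact mul_ne_zero (Finsupp.mem_support_iff.1 ha) (coef_ne_zero H.q_mul i a l)
      obtain ⟨s, hs, has⟩ := h (Finsupp.mem_support_iff.2 hne)
      refine ⟨s, Or.inl hs, ?_⟩
      have hsi : s ≠ i := fun e => hi (e ▸ hs)
      rwa [Pi.add_apply, Pi.single_eq_of_ne hsi, add_zero] at has
  · intro hr
    induction hr using Submodule.span_induction with
    | mem y hy =>
      obtain ⟨s, hs | ⟨rfl, hs⟩, rfl⟩ := hy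
      -- Skew-commutation moves `x s` to the front, where it generates part of the right ideal.
      · rw [H.skew]
        exact Submodule.smul_of_tower_mem _ _
          (Submodule.smul_mem _ (op _) (Submodule.subset_span ⟨s, hs, rfl⟩))
      · rw [gen_mul_gen H.skew s hs]; exact zero_mem _
    | zero => rw [mul_zero]; exact zero_mem _
    | add y z _ _ hy hz => rw [mul_add]; exact add_mem hy hz
    | smul b y _ hy => rw [mul_smul_comm]; exact Submodule.smul_mem _ b hy

/-! ### The grading by the length of the monomials -/

theorem act_mem_supported (n : ℕ) : ∀ r ∈ Submodule.span k (Set.range x) ^ n, ∀ m v,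
    v ∈ Finsupp.supported k k {a : ι → ℕ | ∑ j, a j = m} →
    Φ r v ∈ Finsupp.supported k k {a : ι → ℕ | ∑ j, a j = m + n} := by
  induction n with
  | zero =>
    intro r hr m v hv
    rw [pow_zero, Submodule.mem_one] at hr
    obtain ⟨c, rfl⟩ := hr
    rw [AlgHom.commutes, Module.algebraMap_end_apply]
    exact Submodule.smul_mem _ c hv
  | succ n ih =>
    intro r hr m v hv
    rw [pow_succ] at hr
    refine Submodule.mul_induction_on hr (fun y hy z hz => ?_) (fun y z hy hz => ?_)
    -- The factor split off on the right is a single generator and acts first, raising the length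
    -- from `m` to `m + 1`.
    · rw [map_mul, Module.End.mul_apply, show m + (n + 1) = m + 1 + n by omega]
      refine ih y hy (m + 1) _ ?_
      induction hz using Submodule.span_induction with
      | zero => rw [map_zero]; exact zero_mem _
      | add y z _ _ hy hz => rw [map_add]; exact add_mem hy hz
      | smul c z _ hz => rw [map_smul]; exact Submodule.smul_mem _ c hz
      | mem z hz =>
        obtain ⟨i, rfl⟩ := hz
        rw [H.act, mulGen, Finsupp.linearCombination_apply, Finsupp.sum]
        refine sum_mem fun a ha => Submodule.smul_mem _ _ ?_
        split_ifs
        · exact zero_mem _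
        · refine Finsupp.single_mem_supported k _ ?_
          have : ∑ j, a j = m := hv ha
          simp [Finset.sum_add_distrib, this]
    · rw [map_add]; exact add_mem hy hz

/-- The projection discards all coefficients of monomials of another length. The ideals in question
are described by supports of monomials, so the same projections preserve all of them. -/
theorem isGradingProj : ∃ π : ℕ → A →ₗ[k] A,
    IsGradingProj (fun n => Submodule.span k (Set.range x) ^ n) π ∧
    ∀ S : Set ι, ∀ n, ∀ r ∈ Submodule.span Aᵐᵒᵖ (x '' S),
      π n r ∈ Submodule.span Aᵐᵒᵖ (x '' S) := by
  classical
  let F : ℕ → ((ι → ℕ) →₀ k) →ₗ[k] ((ι → ℕ) →₀ k) := fun n =>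
    { toFun := Finsupp.filter fun a => ∑ j, a j = n
      map_add' := fun _ _ => Finsupp.filter_add
      map_smul' := fun _ _ => Finsupp.filter_smul }
  have hF : ∀ n v, F n v = v.filter fun a => ∑ j, a j = n := fun _ _ => rfl
  have hc : ∀ n, ∀ r ∈ Submodule.span k (Set.range x) ^ n,
      coeffs Φ r ∈ Finsupp.supported k k {a : ι → ℕ | ∑ j, a j = n} := fun n r hr => by
    have := H.act_mem_supported n r hr 0 (Finsupp.single 0 1)
      (Finsupp.single_mem_supported k _ (by simp))
    rwa [zero_add] at this
  refine ⟨fun n => eval x l ∘ₗ F n ∘ₗ coeffs Φ, ⟨?_, ?_, ?_⟩, ?_⟩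
  · intro n r hr
    have : F n (coeffs Φ r) = coeffs Φ r :=
      (hF _ _).trans (Finsupp.filter_eq_self_iff _ _ |>.2 fun a ha =>
        hc n r hr (Finsupp.mem_support_iff.2 ha))
    rw [LinearMap.comp_apply, LinearMap.comp_apply, this, H.eval_coeffs]
  · intro m n hmn r hr
    have : F n (coeffs Φ r) = 0 :=
      (hF _ _).trans (Finsupp.filter_eq_zero_iff _ _ |>.2 fun a ha => by
        by_contra h0
        have : ∑ j, a j = m := hc m r hr (Finsupp.mem_support_iff.2 h0)
        omega)
    rw [LinearMap.comp_apply, LinearMap.comp_apply, this, map_zero]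
  · rw [eq_top_iff]
    rintro r -
    rw [← H.eval_coeffs r, eval, Finsupp.linearCombination_apply, Finsupp.sum]
    refine sum_mem fun a _ => Submodule.smul_mem _ _ ?_
    obtain ⟨n, hn⟩ := mono_mem_pow (k := k) (x := x) a l
    exact Submodule.mem_iSup_of_mem n hn
  · intro S n r hr
    refine H.eval_mem_span S _ fun a ha => ?_
    have ha' : a ∈ (F n (coeffs Φ r)).support := ha
    rw [hF, Finsupp.support_filter, Finset.mem_filter] at ha'
    exact H.coeffs_mem_supported S r hr ha'.1

end IsSkewPolynomial

/-! ### Cyclic modules over a graded algebra -/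

section Cyclic

variable {k : Type u} [Field k] {A : Type w} [Ring A] [Algebra k A]

/-- The grading of `A / I` induced from `A`. -/
def quotDeg (𝒜 : ℕ → Submodule k A) (I : Submodule Aᵐᵒᵖ A) (n : ℕ) : Submodule k (A ⧸ I) :=
  (𝒜 n).map (I.mkQ.restrictScalars k)

/-- Left multiplication as a homomorphism of right modules. -/
def mulLeftRight (x : A) : A →ₗ[Aᵐᵒᵖ] A where
  toFun r := x * r
  map_add' := mul_add x
  map_smul' c r := (mul_assoc x r (unop c)).symm

variable {𝒜 : ℕ → Submodule k A} {π : ℕ → A →ₗ[k] A} {ε : A →ₐ[k] k}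

theorem quotDeg_isGradingProj (h : IsGradingProj 𝒜 π) (I : Submodule Aᵐᵒᵖ A)
    (hI : ∀ n, ∀ r ∈ I, π n r ∈ I) :
    ∃ ρ : ℕ → (A ⧸ I) →ₗ[k] (A ⧸ I), IsGradingProj (quotDeg 𝒜 I) ρ := by
  refine h.of_surjective (I.mkQ.restrictScalars k) I.mkQ_surjective fun n r hr => ?_
  exact (Submodule.Quotient.mk_eq_zero I).2 (hI n r ((Submodule.Quotient.mk_eq_zero I).1 hr))

theorem quotDeg_smul_mem (h𝒜 : SetLike.GradedMonoid 𝒜) (I : Submodule Aᵐᵒᵖ A) (i j : ℕ) :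
    ∀ m ∈ quotDeg 𝒜 I i, ∀ r ∈ 𝒜 j, op r • m ∈ quotDeg 𝒜 I (i + j) := by
  rintro _ ⟨s, hs, rfl⟩ r hr
  exact ⟨s * r, h𝒜.mul_mem hs hr, rfl⟩

/-- The quotient is generated by the class of `1`: for `r` of positive degree, `ε r = 0`, so the
class of `r` is the boundary of `1 ⊗ r`. -/
theorem vanishesAt_zero (hε : ∀ n, 0 < n → ∀ r ∈ 𝒜 n, ε r = 0) (I : Submodule Aᵐᵒᵖ A) (j : ℕ)
    (hj : j ≠ 0) : Bar.VanishesAt ε 𝒜 (quotDeg 𝒜 I) 0 j := by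
  rintro _ ⟨r, hr, rfl⟩ -
  let m : Bar.Obj k A (A ⧸ I) 0 := I.mkQ 1
  refine ⟨Bar.tmul k A (A ⧸ I) 0 m r, ?_⟩
  rw [Bar.d, LinearMap.add_apply, LinearMap.smul_apply, Bar.augLast_tmul,
    hε j (Nat.pos_of_ne_zero hj) r hr, zero_smul, smul_zero, add_zero, Bar.resD_zero_tmul]
  exact congrArg I.mkQ (one_mul r)

theorem vanishesAt_succ_of_eq_bot (I : Submodule Aᵐᵒᵖ A) (hI : I = ⊥) (i j : ℕ) :
    Bar.VanishesAt ε 𝒜 (quotDeg 𝒜 I) (i + 1) j := by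
  refine Bar.vanishesAt_of_free (I.mkQ 1) (I.quotEquivOfEqBot hI).toLinearMap (fun m => ?_)
    ε 𝒜 _ i j
  obtain ⟨r, rfl⟩ := I.mkQ_surjective m
  exact congrArg I.mkQ (one_mul r)

/-- The exact sequence `0 ⟶ A / (I : x) (-1) ⟶ A / I ⟶ A / (x A + I) ⟶ 0`. -/
theorem vanishesAt_succ_of_colon (hπ : IsGradingProj 𝒜 π) (h𝒜 : SetLike.GradedMonoid 𝒜)
    (hε : ∀ n, 0 < n → ∀ r ∈ 𝒜 n, ε r = 0) {x : A} (hx : x ∈ 𝒜 1) {I J K : Submodule Aᵐᵒᵖ A}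
    (hI : ∀ n, ∀ r ∈ I, π n r ∈ I) (hJ : ∀ n, ∀ r ∈ J, π n r ∈ J)
    (hcolon : ∀ r, x * r ∈ I ↔ r ∈ J) (hK : K = Submodule.span Aᵐᵒᵖ {x} ⊔ I) {i j : ℕ}
    (h : Bar.VanishesAt ε 𝒜 (quotDeg 𝒜 I) (i + 1) j)
    (h' : ∀ l, j = l + 1 → Bar.VanishesAt ε 𝒜 (quotDeg 𝒜 J) i l) :
    Bar.VanishesAt ε 𝒜 (quotDeg 𝒜 K) (i + 1) j := by
  obtain ⟨ρI, hρI⟩ := quotDeg_isGradingProj hπ I hI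
  obtain ⟨ρJ, hρJ⟩ := quotDeg_isGradingProj hπ J hJ
  have hIK : I ≤ K := hK ▸ le_sup_right
  have hxK : x ∈ K := hK ▸ Submodule.mem_sup_left (Submodule.mem_span_singleton_self x)
  -- One direction of `hcolon` makes left multiplication by `x` well defined on the quotients, the
  -- other makes it injective.
  let f : (A ⧸ J) →ₗ[Aᵐᵒᵖ] (A ⧸ I) := J.mapQ I (mulLeftRight x) fun r hr => (hcolon r).2 hr
  let p : (A ⧸ I) →ₗ[Aᵐᵒᵖ] (A ⧸ K) := I.mapQ K LinearMap.id hIK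
  have hf : ∀ r, f (J.mkQ r) = I.mkQ (x * r) := fun _ => rfl
  have hp : ∀ r, p (I.mkQ r) = K.mkQ r := fun _ => rfl
  refine h.of_shortExact hπ hρJ hρI h𝒜 hε (quotDeg_smul_mem h𝒜 J) (quotDeg_smul_mem h𝒜 I)
    f p ?_ ?_ ?_ ?_ ?_ h'
  · rw [← LinearMap.ker_eq_bot, LinearMap.ker_eq_bot']
    intro m hm
    obtain ⟨r, rfl⟩ := J.mkQ_surjective m
    rw [hf] at hm
    exact (Submodule.Quotient.mk_eq_zero J).2
      ((hcolon r).1 ((Submodule.Quotient.mk_eq_zero I).1 hm))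
  · intro m
    obtain ⟨r, rfl⟩ := K.mkQ_surjective m
    exact ⟨I.mkQ r, hp r⟩
  · intro m
    obtain ⟨r, rfl⟩ := I.mkQ_surjective m
    rw [hp]
    constructor
    · intro hr
      have hr' : r ∈ K := (Submodule.Quotient.mk_eq_zero K).1 hr
      rw [hK] at hr'
      obtain ⟨y, hy, z, hz, rfl⟩ := Submodule.mem_sup.1 hr'
      obtain ⟨c, rfl⟩ := Submodule.mem_span_singleton.1 hy
      refine ⟨J.mkQ (unop c), ?_⟩
      have hz' : I.mkQ z = 0 := (Submodule.Quotient.mk_eq_zero I).2 hz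
      rw [hf, map_add, hz', add_zero]
      rfl
    · rintro ⟨m, hm⟩
      obtain ⟨s, rfl⟩ := J.mkQ_surjective m
      rw [← hp, ← hm, hf, hp]
      exact (Submodule.Quotient.mk_eq_zero K).2 (K.smul_mem (op s) hxK)
  · rintro n _ ⟨r, hr, rfl⟩
    exact ⟨x * r, add_comm 1 n ▸ h𝒜.mul_mem hx hr, rfl⟩
  · rintro n _ ⟨r, hr, rfl⟩
    exact ⟨I.mkQ r, ⟨r, hr, rfl⟩, hp r⟩

end Cyclic

/-- The ideals generated by sets of generators of a skew polynomial algebra form a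
Koszul filtration. -/
theorem IsSkewPolynomial.vanishesAt {k : Type u} [Field k] {ι : Type*} [DecidableEq ι] [Fintype ι]
    {q : ι → ι → k} {A : Type w} [Ring A] [Algebra k A] {x : ι → A} {l : List ι}
    {Φ : A →ₐ[k] Module.End k ((ι → ℕ) →₀ k)} (H : IsSkewPolynomial q x l Φ) {ε : A →ₐ[k] k}
    {𝒜 : ℕ → Submodule k A} (h𝒜x : ∀ n, 𝒜 n = Submodule.span k (Set.range x) ^ n)
    (h𝒜 : SetLike.GradedMonoid 𝒜) (hε : ∀ n, 0 < n → ∀ r ∈ 𝒜 n, ε r = 0) (i : ℕ) :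
    ∀ (S : Set ι) (j : ℕ), j ≠ i →
      Bar.VanishesAt ε 𝒜 (quotDeg 𝒜 (Submodule.span Aᵐᵒᵖ (x '' S))) i j := by
  obtain ⟨π, hπ, hπS⟩ := H.isGradingProj
  rw [← funext h𝒜x] at hπ
  have hx : ∀ i, x i ∈ 𝒜 1 := fun i => by
    rw [h𝒜x, pow_one]; exact Submodule.subset_span ⟨i, rfl⟩
  induction i with
  | zero => exact fun S j hj => vanishesAt_zero hε _ j hj
  | succ i ih =>
    intro S j hj
    induction S, S.toFinite using Set.Finite.induction_on with
    | empty => exact vanishesAt_succ_of_eq_bot _ (by simp) i j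
    | @insert s S hs _ hS =>
      -- The inner hypothesis `hS` covers the middle term. The kernel belongs to `S` or `insert s
      -- S`, so the outer hypothesis `ih` must be available for all sets; the shift turns `j ≠ i +
      -- 1` into `l ≠ i`.
      refine vanishesAt_succ_of_colon hπ h𝒜 hε (hx s) (hπS S) (hπS _) (H.gen_mul_mem_iff S s hs)
        ?_ hS fun l hl => ih _ l (by omega)
      rw [Set.image_insert_eq, Submodule.span_insert]

/-! ### The enveloping algebra of an abelian color Lie algebra -/

namespace ColorLieAlgebra

variable {Γ : Type w} {k : Type u} [AddCommGroup Γ] [DecidableEq Γ] [Field k]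
  {ε : CommutationFactor Γ k} {g : Type v} [AddCommGroup g] [Module k g]
  (L : ColorLieAlgebra ε g)

/-- A maximal independent subset of `W` is extended to a maximal independent set of homogeneous
elements; the latter spans because the components span `g`. -/
theorem exists_homogeneous_basis [Module.Finite k g] (W : Set g)
    (hW : ∀ x ∈ W, L.IsHomogeneous x) :
    ∃ (ι : Type v) (_ : Fintype ι) (b : Module.Basis ι k g) (γ : ι → Γ) (S : Set ι),
      (∀ i, b i ∈ L.comp (γ i)) ∧ b '' S ⊆ W ∧ W ⊆ Submodule.span k (b '' S) := by
  obtain ⟨s, hsW, -, hWs, hs⟩ := exists_linearIndepOn_id_extension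
    (linearIndepOn_empty k (id : g → g)) (Set.empty_subset W)
  obtain ⟨t, htH, hst, hHt, ht⟩ := exists_linearIndepOn_id_extension hs
    (show s ⊆ {a | L.IsHomogeneous a} from fun a ha => hW a (hsW ha))
  have htop : ⊤ ≤ Submodule.span k (Set.range (Subtype.val : t → g)) := by
    rw [Subtype.range_coe, ← L.isInternal.submodule_iSup_eq_top]
    exact iSup_le fun α a ha => hHt ⟨α, ha⟩
  let b : Module.Basis t k g := Module.Basis.mk ht htop
  have hb : ∀ i : t, b i = i := fun i => Module.Basis.mk_apply ht htop i
  have himg : b '' {i | (i : g) ∈ s} = s := by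
    ext a
    constructor
    · rintro ⟨i, hi, rfl⟩; rw [hb]; exact hi
    · exact fun ha => ⟨⟨a, hst ha⟩, ha, hb _⟩
  choose γ hγ using fun i : t => htH i.2
  refine ⟨t, Module.Basis.fintypeIndexOfRankLtAleph0 b (Module.rank_lt_aleph0 k g), b, γ,
    {i | (i : g) ∈ s}, fun i => by rw [hb]; exact hγ i, ?_, ?_⟩
  · rw [himg]; exact hsW
  · rw [himg]; exact hWs

-- Taking the component of degree `α` in the basis expansion removes every basis vector of another
-- degree.
variable {L} in
theorem mem_span_of_mem_comp {ι : Type*} [Fintype ι] (b : Module.Basis ι k g) {γ : ι → Γ}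
    (hb : ∀ i, b i ∈ L.comp (γ i)) (α : Γ) (a : g) (ha : a ∈ L.comp α) :
    a ∈ Submodule.span k (b '' {i | γ i = α}) := by
  let := L.isInternal.chooseDecomposition
  have h : a = ∑ i, b.repr a i • (DirectSum.decompose L.comp (b i) α : g) := by
    conv_lhs => rw [← DirectSum.decompose_of_mem_same L.comp ha, ← b.sum_repr a]
    simp only [DirectSum.decompose_sum, DirectSum.decompose_smul, DirectSum.sum_apply,
      DirectSum.smul_apply, AddSubmonoidClass.coe_finsetSum, SetLike.val_smul]
  rw [h]
  refine sum_mem fun i _ => Submodule.smul_mem _ _ ?_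
  by_cases hi : γ i = α
  · rw [← hi, DirectSum.decompose_of_mem_same L.comp (hb i), hi]
    exact Submodule.subset_span ⟨i, hi, rfl⟩
  · rw [DirectSum.decompose_of_mem_ne L.comp (hb i) hi]
    exact zero_mem _

theorem adjoin_range_ι : Algebra.adjoin k (Set.range L.ι) = ⊤ := by
  have h : Set.range L.ι = RingQuot.mkAlgHom k L.Rel '' Set.range (TensorAlgebra.ι k) := by
    rw [← Set.range_comp]; rfl
  rw [h, ← AlgHom.map_adjoin, TensorAlgebra.adjoin_range_ι, Algebra.map_top,
    AlgHom.range_eq_top]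
  exact RingQuot.mkAlgHom_surjective k L.Rel

theorem aug_ι (a : g) : L.aug (L.ι a) = 0 := by
  have : L.aug (L.ι a) = TensorAlgebra.lift k (0 : g →ₗ[k] k) (TensorAlgebra.ι k a) :=
    RingQuot.liftAlgHom_mkAlgHom_apply k _ _ _
  rw [this, TensorAlgebra.lift_ι_apply, LinearMap.zero_apply]

theorem aug_ueaDeg (n : ℕ) (hn : 0 < n) (r : L.UEA) (hr : r ∈ L.ueaDeg n) : L.aug r = 0 := by
  obtain ⟨n, rfl⟩ := Nat.exists_eq_succ_of_ne_zero hn.ne'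
  rw [ueaDeg, pow_succ] at hr
  refine Submodule.mul_induction_on hr ?_ fun y z hy hz => by rw [map_add, hy, hz, add_zero]
  rintro y - _ ⟨a, rfl⟩
  rw [map_mul, aug_ι, mul_zero]

theorem ueaDeg_gradedMonoid : SetLike.GradedMonoid L.ueaDeg where
  one_mem := Submodule.one_le.1 (pow_zero (LinearMap.range L.ι)).ge
  mul_mem i j x y hx hy := by
    rw [ueaDeg, pow_add]; exact Submodule.mul_mem_mul hx hy

variable {L} in
theorem ι_mul_ι (hL : L.IsAbelian) {α β : Γ} {a b : g} (ha : a ∈ L.comp α) (hb : b ∈ L.comp β) :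
    L.ι a * L.ι b = (ε.toFun α β : k) • (L.ι b * L.ι a) := by
  have h := RingQuot.mkAlgHom_rel k (Rel.mk α β a b ha hb : L.Rel _ _)
  rw [hL a b, map_zero, map_zero, map_sub, map_smul, map_mul, map_mul] at h
  exact sub_eq_zero.1 h

open SkewMonomial in
variable {L} in
/-- The Poincaré–Birkhoff–Witt theorem for abelian color Lie algebras. -/
theorem exists_isSkewPolynomial (hL : L.IsAbelian) {ι : Type*} [Fintype ι] [DecidableEq ι]
    (b : Module.Basis ι k g) {γ : ι → Γ} (hb : ∀ i, b i ∈ L.comp (γ i)) :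
    ∃ Φ, IsSkewPolynomial (fun i j => (ε.toFun (γ i) (γ j) : k)) (fun i => L.ι (b i))
      (Finset.univ : Finset ι).toList Φ := by
  set q : ι → ι → k := fun i j => (ε.toFun (γ i) (γ j) : k) with hqdef
  set l := (Finset.univ : Finset ι).toList
  have hq : ∀ i j, q i j * q j i = 1 := fun i j => by
    simp only [hqdef]
    rw [← Units.val_mul, ε.skew, Units.val_one]
  have hl : l.Nodup := Finset.nodup_toList _
  have hmem : ∀ i, i ∈ l := fun i => Finset.mem_toList.2 (Finset.mem_univ i)
  let ξ : g →ₗ[k] Module.End k ((ι → ℕ) →₀ k) := b.constr k (mulGen q l)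
  have hξ : ∀ i, ξ (b i) = mulGen q l i := fun i => b.constr_basis k _ i
  have hrel : ∀ α β, ∀ a ∈ L.comp α, ∀ c ∈ L.comp β,
      ξ a * ξ c = (ε.toFun α β : k) • (ξ c * ξ a) := by
    intro α β a ha c hc
    -- The relation is bilinear for fixed `α` and `β`, so it suffices to check it on basis vectors
    -- of exactly these degrees.
    have ha' := mem_span_of_mem_comp b hb α a ha
    have hc' := mem_span_of_mem_comp b hb β c hc
    clear ha hc
    induction ha' using Submodule.span_induction with
    | zero => simp
    | add y z _ _ hy hz => rw [map_add, add_mul, mul_add, smul_add, hy, hz]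
    | smul t y _ hy => rw [map_smul, smul_mul_assoc, mul_smul_comm, hy, smul_comm]
    | mem y hy =>
      obtain ⟨i, rfl, rfl⟩ := hy
      induction hc' using Submodule.span_induction with
      | zero => simp
      | add y z _ _ hy hz => rw [map_add, add_mul, mul_add, smul_add, hy, hz]
      | smul t y _ hy => rw [map_smul, smul_mul_assoc, mul_smul_comm, hy, smul_comm]
      | mem y hy =>
        obtain ⟨j, rfl, rfl⟩ := hy
        rw [hξ, hξ]
        exact mulGen_comm hq l hl hmem i j
  let Φ : L.UEA →ₐ[k] Module.End k ((ι → ℕ) →₀ k) :=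
    RingQuot.liftAlgHom k ⟨TensorAlgebra.lift k ξ, by
      rintro _ _ ⟨α, β, a, c, ha, hc⟩
      rw [hL a c, map_zero, map_zero, map_sub, map_smul, map_mul, map_mul,
        TensorAlgebra.lift_ι_apply, TensorAlgebra.lift_ι_apply, hrel α β a ha c hc, sub_self]⟩
  have hΦ : ∀ a, Φ (L.ι a) = ξ a := fun a =>
    (RingQuot.liftAlgHom_mkAlgHom_apply k _ _ _).trans (TensorAlgebra.lift_ι_apply ξ a)
  refine ⟨Φ, hq, hl, hmem, fun i j => ι_mul_ι hL (hb i) (hb j), ?_, fun i => ?_⟩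
  · rw [← Algebra.adjoin_span, ← top_le_iff, ← L.adjoin_range_ι]
    refine Algebra.adjoin_mono ?_
    rintro _ ⟨a, rfl⟩
    rw [← b.sum_repr a, map_sum]
    refine sum_mem fun i _ => ?_
    rw [map_smul]
    exact Submodule.smul_mem _ _ (Submodule.subset_span ⟨i, rfl⟩)
  · rw [hΦ, hξ]

theorem ueaDeg_eq {ι : Type*} (b : Module.Basis ι k g) (n : ℕ) :
    L.ueaDeg n = Submodule.span k (Set.range fun i => L.ι (b i)) ^ n := by
  rw [ueaDeg, LinearMap.range_eq_map, ← b.span_eq, Submodule.map_span, ← Set.range_comp]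
  rfl

theorem rightIdeal_eq {W W' : Set g} (h : W' ⊆ W) (h' : W ⊆ Submodule.span k W') :
    L.rightIdeal W = L.rightIdeal W' := by
  refine le_antisymm (Submodule.span_le.2 ?_) (Submodule.span_mono (Set.image_mono h))
  rintro _ ⟨a, ha, rfl⟩
  have hle : Submodule.span k W' ≤ ((L.rightIdeal W').restrictScalars k).comap L.ι :=
    Submodule.span_le.2 fun c hc => Submodule.subset_span ⟨c, hc, rfl⟩
  exact hle (h' ha)

theorem ueaDeg_finite [Module.Finite k g] (n : ℕ) : Module.Finite k (L.ueaDeg n) :=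
  Module.Finite.iff_fg.2 (Submodule.FG.pow (Module.Finite.iff_fg.1 inferInstance) n)

theorem cyclicDeg_eq (W : Set g) : L.cyclicDeg W = quotDeg L.ueaDeg (L.rightIdeal W) := rfl

end ColorLieAlgebra

end

theorem mainTheorem9 {k : Type u} [Field k] (h2 : (2 : k) ≠ 0) (h3 : (3 : k) ≠ 0)
    {Γ : Type w} [AddCommGroup Γ] [DecidableEq Γ] (ε : CommutationFactor Γ k)
    {g : Type v} [AddCommGroup g] [Module k g] [Module.Finite k g]
    (L : ColorLieAlgebra ε g) (hL : L.IsAbelian)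
    (W : Set g) (hW : ∀ x ∈ W, L.IsHomogeneous x) :
    (∀ i : ℕ, DirectSum.IsInternal (L.homologyDeg W i) ∧
      ∀ j : ℕ, j ≠ i → L.homologyDeg W i j = ⊥) ∧
    IsKoszulModule L.aug L.ueaDeg (L.cyclicDeg W) 0 := by
  classical
  obtain ⟨ι, _, b, γ, S, hb, hSW, hWS⟩ := L.exists_homogeneous_basis W hW
  obtain ⟨Φ, H⟩ := ColorLieAlgebra.exists_isSkewPolynomial hL b hb
  -- The ideal depends only on the linear span of `W`, so `W` may be replaced by a set of basis
  -- vectors.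
  have hI : L.rightIdeal W = Submodule.span L.UEAᵐᵒᵖ ((fun i => L.ι (b i)) '' S) := by
    rw [L.rightIdeal_eq hSW hWS, ColorLieAlgebra.rightIdeal, Set.image_image]
  have hmon := L.ueaDeg_gradedMonoid
  have hdeg : L.ueaDeg = fun n => Submodule.span k (Set.range fun i => L.ι (b i)) ^ n :=
    funext (L.ueaDeg_eq b)
  obtain ⟨π, hπ, hπS⟩ := H.isGradingProj
  rw [← hdeg] at hπ
  obtain ⟨ρ, hρ⟩ := quotDeg_isGradingProj hπ (L.rightIdeal W) (by rw [hI]; exact hπS S)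
  have hsmul := quotDeg_smul_mem hmon (L.rightIdeal W)
  have hvan : ∀ i j, j ≠ i → L.homologyDeg W i j = ⊥ := fun i j hij => by
    refine algHomologyDeg_eq_bot ?_
    rw [L.cyclicDeg_eq]
    have := H.vanishesAt (L.ueaDeg_eq b) hmon L.aug_ueaDeg i S j hij
    rwa [← hI] at this
  have hint : ∀ i, DirectSum.IsInternal (L.homologyDeg W i) := fun i =>
    algHomologyDeg_isInternal L.aug hπ hρ hmon L.aug_ueaDeg hsmul i
  have hfin := L.ueaDeg_finite
  refine ⟨fun i => ⟨hint i, hvan i⟩, ⟨hπ.isInternal, hmon, hfin, pow_zero _, ?_, L.aug_ueaDeg⟩,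
    ⟨hρ.isInternal, hsmul, fun n => ?_⟩, hint, fun i j hj => hvan i j hj⟩
  · rw [ColorLieAlgebra.ueaDeg, pow_one]
    exact L.adjoin_range_ι
  · have := hfin n
    exact inferInstanceAs (Module.Finite k ((L.ueaDeg n).map _))
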